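/- **Setting.** Let $n\ge 2$ and consider the plant $\dot x_i=h_i(x_1,\dots,x_{i+1})$ $(1\le i\le n-1)$, $\dot x_n=g(t)+h_n(x_1,\dots,x_n)$, with output $y=x_1$, smooth functions $h_i$ and the state constraints $-\rho_{i1}<x_i<\rho_{i2}$, where $\rho_{i1},\rho_{i2}>0$. Let $y_m=x_r$ be a smooth reference with $-\rho_{11}+\eta_0\le x_r(t)\le\rho_{12}-\eta_0$ for some $\eta_0>0$ and with $\dot x_r$ bounded on $[0,\infty)$. Put $$w_i=\log\frac{\rho_{i1}+x_i}{\rho_{i2}-x_i},\quad w_s=\log\frac{\rho_{11}+x_r}{\rho_{12}-x_r},\quad \Delta_i(v)=\frac{e^{v}+e^{-v}+2}{\rho_{i1}+\rho_{i2}},$$ $L_i=\Delta_i(w_i)h_i-w_{i+1}$ for $i<n$, and $L_n=\Delta_n(w_n)h_n$. **Controller.** Let $0<p<1<q$; let $k_{1,i},k_{2,i},\tau_i,u_i>0$, $f_i>\frac12$ and $\varepsilon_i=\frac{2f_i}{2f_i-1}$. For real $z$ and $r$, $[z]^{r}$ denotes $\operatorname{sign}(z)|z|^{r}$. The $i$-th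 network has the basis functions $\Omega_{i,l}(W)=\exp(-\|W-\mu_{i,l}\|/D_i)$ with $D_i>0$, and the input $Z_i=(w_1,\dots,w_i,\hat\varphi_1,\dots,\hat\varphi_{i-1},w_s,\dot w_s,\dots,w_s^{(i)})$. With $z_1=w_1-w_s$ and $z_i=w_i-\alpha_{i-1}$ for $i\ge2$, put $$\alpha_i=-k_{1,i}[z_i]^{2q-1}-\tfrac{1}{2u_i^2}z_i\hat\varphi_i\|\Omega_i(Z_i)\|^2+\delta_{i1}\dot w_s\quad(1\le i<n),$$ $$\alpha_n=\tfrac1{\Delta_n(w_n)}\Big(-k_{1,n}[z_n]^{2q-1}-\tfrac1{2u_n^2}z_n\hat\varphi_n\|\Omega_n(Z_n)\|^2\Big),\qquad \dot{\hat\varphi}_i=\tfrac{\varepsilon_i}{2u_i^2}z_i^2\|\Omega_i(Z_i)\|^2-\tau_i\hat\varphi_i\quad(1\le i\le n).$$ **Triggering.** With $\Phi>0$, the two adaptive controllers are $$d_{\rm fix}=\alpha_n-\bar\vartheta\tanh\tfrac{z_n\bar\vartheta}{\Phi},\qquad d_{\rm rel}=-(1+\theta)\Big(\alpha_n\tanh\tfrac{z_n\alpha_n}{\Phi}+\bar\vartheta_1\tanh\tfrac{z_n\bar\vartheta_1}{\Phi}\Big).$$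 The input is $g(t)=d(t_j)$ on $[t_j,t_{j+1})$; the first triggering time is $0$, and $e=d-g$. One of the following schemes is used. 1. *Fixed*: $d=d_{\rm fix}$ and $t_{j+1}=\inf\{t>t_j:|e(t)|\ge\vartheta\}$. 2. *Relative*: $d=d_{\rm rel}$ and $t_{j+1}=\inf\{t>t_j:|e(t)|\ge\theta|g|+\vartheta_1\}$. 3. *Switched*: the rule of scheme 2 with $d=d_{\rm rel}$ if $|g(t_j)|<G$; the rule $|e|\ge\vartheta$ of scheme 1 if $|g(t_j)|\ge G$, with $d=d_{\rm fix}$ or, provided that $\vartheta<\bar\vartheta_1$, with $d=d_{\rm rel}$ on that interval. The error in the inf is computed with the law chosen on that interval. 4. *Self-triggered*: $d=d_{\rm rel}$ and $t_{j+1}=t_j+(\theta|g|+\vartheta_1)/m_j$, where $m_j=\sup\max\{|\dot d(t)|,\pi_0\}<\infty$ over the inter-event interval $[t_j,t_{j+1})$. (An infimum over the empty set is $\infty$.) The parameters satisfy $0<\vartheta<\bar\vartheta$ where the fixed threshold is used (schemes 1, 3), $0<\theta<1$, $\vartheta_1>0$ and $\bar\vartheta_1>\vartheta_1/(1-\theta)$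 where the relative one is used (schemes 2, 3, 4), and $\pi_0>0$ in scheme 4. **Assumptions on a solution.** Solutions of the closed loop are considered on $[0,T)$ with $0<T\le\infty$: $x_i$ and $\hat\varphi_i$ are continuous, the states satisfy the constraints, the differential equations hold for right derivatives, and the intervals $[t_j,t_{j+1})$ cover $[0,T)$. Let $$U_i=L_i+\tfrac12z_i+k_{2,i}[z_i]^{2p-1}+(z_{i-1}-\dot\alpha_{i-1})$$ (time derivatives are right derivatives; the last bracket is absent for $i=1$). Let $H_i$ be ideal constant weights, $\lambda_i$ accuracies, $R$ a constant, and assume that on $[0,T)$ $$|U_i-H_i^{T}\Omega_i(Z_i)|\le\lambda_i\ \ (1\le i\le n)\qquad\text{and}\qquad \Delta_n(w_n)\le R .$$ **Constants.** Put $\varphi_i=\|H_i\|^2$, $\tilde\varphi_i=\varphi_i-\hat\varphi_i$ and $V=\sum_{i=1}^n\big(\frac{z_i^2}{2}+\frac{\tilde\varphi_i^2}{2\varepsilon_i}\big)$. Let $0<I<1$, $\kappa=\min_{1\le i\le n}\{2^qk_{1,i},2^pk_{2,i},\tau_i\}$, $a=\kappa/(n+1)^q$, $b=\kappa$, $\Lambda=0.2785R\Phi,\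 0.557R\Phi,\ 0.8355R\Phi,\ 0.557R\Phi$ for schemes 1, 2, 3, 4, and for $\gamma=(\gamma_1,\dots,\gamma_n)$ $$c=\sum_{i=1}^n\Big(\frac{u_i^2}{2}+\frac{\lambda_i^2}{2}+\frac{f_i\tau_i}{2}\varphi_i^2\Big)+\kappa(1-p)p^{\frac p{1-p}}+\Lambda+\frac{\kappa}{n+1}\Big(\sum_{i=1}^n\frac{\gamma_i^2}{2\varepsilon_i}\Big)^{q}.$$ **Theorem.** The closed loop is semi-globally practically fixed-time stable in the following sense. 1. For every $M$ there are $B$ and $\eta>0$ such that for every such solution, on any $[0,T)$, with $V(0)\le M$, and for all $t\in[0,T)$: $-\rho_{i1}+\eta\le x_i\le\rho_{i2}-\eta$, and $|w_i|,|z_i|,|\alpha_i|,|\hat\varphi_i|,|\tilde\varphi_i|\le B$ for $1\le i\le n$, and $|d|,|g|\le B$. 2. For every such solution and every $\gamma$ with $|\tilde\varphi_i(t)|\le\gamma_i$ for all $i$ and all $t\in[0,T)$ (by part 1, such a $\gamma$ exists and can be chosen uniformly for $V(0)\le M$), and for all $t\in[0,T)$ with $$t\ge T_{\max}=\frac1{aI(q-1)}+\frac1{bI(1-p)},$$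 one has $$V(t)\le\min\Big\{\Big(\frac{c}{(1-I)a}\Big)^{1/q},\Big(\frac{c}{(1-I)b}\Big)^{1/p}\Big\}.$$ The tracking error satisfies $|w_1-w_s|\le2\big(\frac{c}{(1-I)a}\big)^{\frac1{2q}}$ in the transformed coordinates and $|y-y_m|\le\frac{\sqrt2}{4}(\rho_{11}+\rho_{12})\big(\frac{c}{(1-I)a}\big)^{\frac1{2q}}$ in the original ones; the latter is at most $2\big(\frac{c}{(1-I)a}\big)^{\frac1{2q}}$ when $\rho_{11}+\rho_{12}\le4\sqrt2$. The time $T_{\max}$ depends only on the design parameters, not on initial conditions. -/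

import Mathlib

open scoped ContDiff

namespace FixedTimeETC

noncomputable section

/-- Signed power `sign(z) |z|^r`: the meaning of `z^r` for a real base `z` and a real exponent `r`. -/
def sig (r z : ℝ) : ℝ := Real.sign z * |z| ^ r

/-- The plant. States are numbered `1, …, n`; `h i` is a function of the first `min (i+1) n` states,
and the state `x i` is constrained to the interval `(-ρ₁ i, ρ₂ i)`. -/
structure Plant (n : ℕ) where
  h : (i : ℕ) → (Fin (min (i + 1) n) → ℝ) → ℝ
  ρ₁ : ℕ → ℝ
  ρ₂ : ℕ → ℝ
  smooth_h : ∀ i, 1 ≤ i → i ≤ n → ContDiff ℝ ∞ (h i)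
  ρ₁_pos : ∀ i, 1 ≤ i → i ≤ n → 0 < ρ₁ i
  ρ₂_pos : ∀ i, 1 ≤ i → i ≤ n → 0 < ρ₂ i

/-- The four triggering schemes. -/
inductive Scheme where
  | fixed
  | relative
  | switched
  | selfTriggered

/-- The two adaptive controllers from which the control value is sampled. -/
inductive Law where
  | fixed
  | relative

/-- Input space of the `i`-th neural network: `(w₁,…,wᵢ)`, `(φ̂₁,…,φ̂ᵢ₋₁)` and
`(w_s, w_s', …, w_s⁽ⁱ⁾)`. -/
abbrev NNInput (i : ℕ) : Type := EuclideanSpace ℝ (Fin i ⊕ Fin (i - 1) ⊕ Fin (i + 1))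

/-- Design data of the controller: exponents, gains, the neurons (numbers, centers, widths), and the
parameters of the triggering mechanisms. -/
structure Controller (n : ℕ) where
  p : ℝ
  q : ℝ
  k₁ : ℕ → ℝ
  k₂ : ℕ → ℝ
  τ : ℕ → ℝ
  u : ℕ → ℝ
  f : ℕ → ℝ
  N : ℕ → ℕ
  center : (i : ℕ) → Fin (N i) → NNInput i
  width : ℕ → ℝ
  /-- parameter of the `tanh` terms -/
  Φ : ℝ
  /-- fixed threshold, and its counterpart in the controller -/
  ϑ : ℝ
  ϑbar : ℝ
  /-- relative threshold `θ |g| + ϑ₁`, and the counterpart of `ϑ₁` in the controller -/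
  θ : ℝ
  ϑ₁ : ℝ
  ϑ₁bar : ℝ
  /-- switching level -/
  G : ℝ
  /-- lower bound for the rate used by the self-triggered scheme -/
  rate : ℝ
  p_pos : 0 < p
  p_lt : p < 1
  q_gt : 1 < q
  k₁_pos : ∀ i, 1 ≤ i → i ≤ n → 0 < k₁ i
  k₂_pos : ∀ i, 1 ≤ i → i ≤ n → 0 < k₂ i
  τ_pos : ∀ i, 1 ≤ i → i ≤ n → 0 < τ i
  u_pos : ∀ i, 1 ≤ i → i ≤ n → 0 < u i
  f_gt : ∀ i, 1 ≤ i → i ≤ n → 1 / 2 < f i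
  width_pos : ∀ i, 1 ≤ i → i ≤ n → 0 < width i
  Φ_pos : 0 < Φ

/-- Conditions on the parameters of the triggering mechanism that a scheme uses. -/
def Controller.Admissible {n : ℕ} (C : Controller n) : Scheme → Prop
  | .fixed => 0 < C.ϑ ∧ C.ϑ < C.ϑbar
  | .relative => 0 < C.θ ∧ C.θ < 1 ∧ 0 < C.ϑ₁ ∧ C.ϑ₁ / (1 - C.θ) < C.ϑ₁bar
  | .switched => (0 < C.ϑ ∧ C.ϑ < C.ϑbar) ∧
      (0 < C.θ ∧ C.θ < 1 ∧ 0 < C.ϑ₁ ∧ C.ϑ₁ / (1 - C.θ) < C.ϑ₁bar)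
  | .selfTriggered => (0 < C.θ ∧ C.θ < 1 ∧ 0 < C.ϑ₁ ∧ C.ϑ₁ / (1 - C.θ) < C.ϑ₁bar) ∧ 0 < C.rate

/-- `ε i = 2 f i / (2 f i - 1)`. -/
def Controller.ε {n : ℕ} (C : Controller n) (i : ℕ) : ℝ := 2 * C.f i / (2 * C.f i - 1)

/-- Signals of the closed loop: states, adaptive estimates, continuously computed controller `d`,
applied input `g`. -/
structure Signals where
  x : ℕ → ℝ → ℝ
  φhat : ℕ → ℝ → ℝ
  d : ℝ → ℝ
  g : ℝ → ℝ

section Loop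

variable {n : ℕ} (P : Plant n) (C : Controller n) (xr : ℝ → ℝ) (S : Signals)

/-- The factor `Δ i` with `w i' = Δ i (w i) * x i'`. -/
def Delta (i : ℕ) (v : ℝ) : ℝ := (Real.exp v + Real.exp (-v) + 2) / (P.ρ₁ i + P.ρ₂ i)

/-- Transformed states. -/
def w (i : ℕ) (t : ℝ) : ℝ := Real.log ((P.ρ₁ i + S.x i t) / (P.ρ₂ i - S.x i t))

/-- Transformed reference. -/
def ws (t : ℝ) : ℝ := Real.log ((P.ρ₁ 1 + xr t) / (P.ρ₂ 1 - xr t))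

/-- `h i` evaluated along the states. -/
def drift (i : ℕ) (t : ℝ) : ℝ := P.h i (fun j => S.x ((j : ℕ) + 1) t)

/-- The functions `L i` of the auxiliary system, along the states. -/
def aux (i : ℕ) (t : ℝ) : ℝ :=
  Delta P i (w P S i t) * drift P S i t - if i < n then w P S (i + 1) t else 0

/-- The input of the `i`-th neural network at time `t`. -/
def Z (i : ℕ) (t : ℝ) : NNInput i :=
  WithLp.toLp 2 (Sum.elim (fun j : Fin i => w P S ((j : ℕ) + 1) t)
    (Sum.elim (fun j : Fin (i - 1) => S.φhat ((j : ℕ) + 1) t)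
      (fun j : Fin (i + 1) => iteratedDeriv (j : ℕ) (ws P xr) t)))

/-- The vector of radial basis functions of the `i`-th network. -/
def basis (i : ℕ) (W : NNInput i) : EuclideanSpace ℝ (Fin (C.N i)) :=
  WithLp.toLp 2 (fun l => Real.exp (-‖W - C.center i l‖ / C.width i))

/-- The virtual control laws `α i`, `1 ≤ i ≤ n-1`, with the convention `α 0 = w_s`. -/
def virt : ℕ → ℝ → ℝ
  | 0 => ws P xr
  | i + 1 => fun t =>
      -C.k₁ (i + 1) * sig (2 * C.q - 1) (w P S (i + 1) t - virt i t)
        - 1 / (2 * C.u (i + 1) ^ 2) * (w P S (i + 1) t - virt i t) * S.φhat (i + 1) t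
            * ‖basis C (i + 1) (Z P xr S (i + 1) t)‖ ^ 2
        + if i = 0 then deriv (ws P xr) t else 0

/-- The errors `z 1 = w 1 - w_s` and `z i = w i - α (i-1)` for `2 ≤ i ≤ n`. -/
def z (i : ℕ) (t : ℝ) : ℝ := w P S i t - virt P C xr S (i - 1) t

/-- The actual controller `α n`. -/
def alphaN (t : ℝ) : ℝ :=
  1 / Delta P n (w P S n t) *
    (-C.k₁ n * sig (2 * C.q - 1) (z P C xr S n t)
      - 1 / (2 * C.u n ^ 2) * z P C xr S n t * S.φhat n t * ‖basis C n (Z P xr S n t)‖ ^ 2)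

/-- The lumped unknown functions that the networks approximate. Time derivatives are right
derivatives, since signals may have corners at triggering times. -/
def lumped (i : ℕ) (t : ℝ) : ℝ :=
  aux P S i t + z P C xr S i t / 2 + C.k₂ i * sig (2 * C.p - 1) (z P C xr S i t)
    + if i = 1 then 0
      else z P C xr S (i - 1) t - derivWithin (virt P C xr S (i - 1)) (Set.Ici t) t

/-- The two adaptive controllers. -/
def dLaw : Law → ℝ → ℝ
  | .fixed => fun t => alphaN P C xr S t - C.ϑbar * Real.tanh (z P C xr S n t * C.ϑbar / C.Φ)
  | .relative => fun t => -(1 + C.θ) *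
      (alphaN P C xr S t * Real.tanh (z P C xr S n t * alphaN P C xr S t / C.Φ)
        + C.ϑ₁bar * Real.tanh (z P C xr S n t * C.ϑ₁bar / C.Φ))

/-- The threshold that is in force while the value `v` is applied. -/
def threshold (s : Scheme) (v : ℝ) : ℝ :=
  match s with
  | .fixed => C.ϑ
  | .relative => C.θ * |v| + C.ϑ₁
  | .switched => if |v| < C.G then C.θ * |v| + C.ϑ₁ else C.ϑ
  | .selfTriggered => C.θ * |v| + C.ϑ₁

/-- Which adaptive controller may be running while the value `v` is applied. -/
def LawAllowed (s : Scheme) (v : ℝ) (l : Law) : Prop :=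
  match s with
  | .fixed => l = .fixed
  | .relative => l = .relative
  | .switched => (|v| < C.G → l = .relative) ∧
      (C.G ≤ |v| → l = .fixed ∨ (l = .relative ∧ C.ϑ < C.ϑ₁bar))
  | .selfTriggered => l = .relative

/-- `next` is the triggering time that follows the time `s₀`, for a loop that exists on `[0, T)`, when
the adaptive controller `D` runs and the value `D s₀` is applied. For the event-triggered schemes it
is the first time at which the measurement error reaches the threshold (`⊤` if there is none); for
the self-triggered scheme it is `s₀ + (θ |g| + ϑ₁) / max {|d'|, rate}`, the maximum being taken over
the inter-event interval. -/
def NextTrigger (T : EReal) (s : Scheme) (D : ℝ → ℝ) (s₀ : ℝ) (next : EReal) : Prop :=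
  match s with
  | .selfTriggered => ∃ m : ℝ,
      IsLUB {r : ℝ | ∃ t : ℝ, s₀ ≤ t ∧ (t : EReal) < next ∧ (t : EReal) < T ∧
        r = max |derivWithin D (Set.Ici t) t| C.rate} m ∧
      next = ((s₀ + threshold C s (D s₀) / m : ℝ) : EReal)
  | _ => next = sInf {r : EReal | ∃ t : ℝ, s₀ < t ∧ (t : EReal) < T ∧
        threshold C s (D s₀) ≤ |D t - D s₀| ∧ r = (t : EReal)}

/-- `S` is a solution on `[0, T)`, `0 < T ≤ ∞`, of the closed loop of plant, virtual control laws,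
actual controller, adaptive laws and triggering scheme `s`. Here `tk 0, tk 1, …` are the
triggering times and `law j` is the adaptive controller that runs on `[tk j, tk (j+1))`. -/
structure IsSolution (s : Scheme) (T : EReal) (tk : ℕ → EReal) (law : ℕ → Law) : Prop where
  T_pos : 0 < T
  x_cont : ∀ i, 1 ≤ i → i ≤ n → ContinuousOn (S.x i) {t : ℝ | 0 ≤ t ∧ (t : EReal) < T}
  φ_cont : ∀ i, 1 ≤ i → i ≤ n → ContinuousOn (S.φhat i) {t : ℝ | 0 ≤ t ∧ (t : EReal) < T}
  x_mem : ∀ i, 1 ≤ i → i ≤ n → ∀ t : ℝ, 0 ≤ t → (t : EReal) < T →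
    -P.ρ₁ i < S.x i t ∧ S.x i t < P.ρ₂ i
  x_eq : ∀ i, 1 ≤ i → i < n → ∀ t : ℝ, 0 ≤ t → (t : EReal) < T →
    HasDerivWithinAt (S.x i) (drift P S i t) (Set.Ici t) t
  xn_eq : ∀ t : ℝ, 0 ≤ t → (t : EReal) < T →
    HasDerivWithinAt (S.x n) (S.g t + drift P S n t) (Set.Ici t) t
  φ_eq : ∀ i, 1 ≤ i → i ≤ n → ∀ t : ℝ, 0 ≤ t → (t : EReal) < T →
    HasDerivWithinAt (S.φhat i)
      (C.ε i / (2 * C.u i ^ 2) * z P C xr S i t ^ 2 * ‖basis C i (Z P xr S i t)‖ ^ 2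
        - C.τ i * S.φhat i t) (Set.Ici t) t
  tk_zero : tk 0 = 0
  tk_cover : ∀ t : ℝ, 0 ≤ t → (t : EReal) < T → ∃ j, tk j ≤ t ∧ (t : EReal) < tk (j + 1)
  tk_next : ∀ j, tk j < T →
    NextTrigger C T s (dLaw P C xr S (law j)) (tk j).toReal (tk (j + 1))
  tk_top : ∀ j, T ≤ tk j → tk (j + 1) = ⊤
  law_allowed : ∀ j, tk j < T →
    LawAllowed C s (dLaw P C xr S (law j) (tk j).toReal) (law j)
  d_eq : ∀ j, ∀ t : ℝ, tk j ≤ t → (t : EReal) < tk (j + 1) → (t : EReal) < T →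
    S.d t = dLaw P C xr S (law j) t
  g_eq : ∀ j, ∀ t : ℝ, tk j ≤ t → (t : EReal) < tk (j + 1) → (t : EReal) < T →
    S.g t = S.d (tk j).toReal

/-- Along the solution, the network with ideal weights `H i` represents the `i`-th lumped unknown
function with accuracy `lam i`. -/
def Approximates (H : (i : ℕ) → EuclideanSpace ℝ (Fin (C.N i))) (lam : ℕ → ℝ) (T : EReal) : Prop :=
  ∀ i, 1 ≤ i → i ≤ n → ∀ t : ℝ, 0 ≤ t → (t : EReal) < T →
    |lumped P C xr S i t - inner ℝ (H i) (basis C i (Z P xr S i t))| ≤ lam i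

/-- The estimation error `φ i - φ̂ i`, where `φ i = ‖H i‖²`. -/
def φtilde (H : (i : ℕ) → EuclideanSpace ℝ (Fin (C.N i))) (i : ℕ) (t : ℝ) : ℝ :=
  ‖H i‖ ^ 2 - S.φhat i t

/-- The Lyapunov function `V n`. -/
def V (H : (i : ℕ) → EuclideanSpace ℝ (Fin (C.N i))) (t : ℝ) : ℝ :=
  ∑ i ∈ Finset.Icc 1 n, (z P C xr S i t ^ 2 / 2 + φtilde C S H i t ^ 2 / (2 * C.ε i))

/-- The transformed signal `α i`: virtual laws for `i < n`, the actual controller for `i = n`. -/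
def alpha (i : ℕ) (t : ℝ) : ℝ := if i = n then alphaN P C xr S t else virt P C xr S i t

end Loop

section Constants

variable {n : ℕ} (C : Controller n)

/-- `min {2^q k₁ o, 2^p k₂ o, τ o : o = 1, …, n}` -/
def gainMin : ℝ :=
  ⨅ o : Fin n, min (min (2 ^ C.q * C.k₁ (o + 1)) (2 ^ C.p * C.k₂ (o + 1))) (C.τ (o + 1))

def aConst : ℝ := gainMin C / ((n : ℝ) + 1) ^ C.q

def bConst : ℝ := gainMin C

/-- The contribution of the triggering scheme; `R` bounds `Δ n` along the solution. -/
def triggerConst (s : Scheme) (R : ℝ) : ℝ :=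
  match s with
  | .fixed => 0.2785 * R * C.Φ
  | .relative => 0.557 * R * C.Φ
  | .switched => 0.8355 * R * C.Φ
  | .selfTriggered => 0.557 * R * C.Φ

/-- The residual constant; `γ i` bounds the `i`-th estimation error along the solution. -/
def cConst (H : (i : ℕ) → EuclideanSpace ℝ (Fin (C.N i))) (lam : ℕ → ℝ) (s : Scheme) (R : ℝ)
    (γ : ℕ → ℝ) : ℝ :=
  ∑ i ∈ Finset.Icc 1 n,
      (C.u i ^ 2 / 2 + lam i ^ 2 / 2 + C.f i * C.τ i / 2 * (‖H i‖ ^ 2) ^ 2)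
    + gainMin C * ((1 - C.p) * C.p ^ (C.p / (1 - C.p)))
    + triggerConst C s R
    + gainMin C / ((n : ℝ) + 1) * (∑ i ∈ Finset.Icc 1 n, γ i ^ 2 / (2 * C.ε i)) ^ C.q

/-- `T_max = 1/(a I (q-1)) + 1/(b I (1-p))` -/
def settlingTime (I : ℝ) : ℝ :=
  1 / (aConst C * I * (C.q - 1)) + 1 / (bConst C * I * (1 - C.p))

end Constants

/-- Reference signals: smooth, inside the constraint interval of the first state with a margin, and
with bounded velocity. -/
def AdmissibleReference {n : ℕ} (P : Plant n) (xr : ℝ → ℝ) : Prop :=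
  ContDiff ℝ ∞ xr ∧
  (∃ η > 0, ∀ t : ℝ, 0 ≤ t → -P.ρ₁ 1 + η ≤ xr t ∧ xr t ≤ P.ρ₂ 1 - η) ∧
  ∃ K : ℝ, ∀ t : ℝ, 0 ≤ t → |deriv xr t| ≤ K

end

end FixedTimeETC

namespace FixedTimeETC

open Set Filter Topology

/-! ### Signed powers -/

/-! The proof rests on a dissipation inequality for `V`, read with right derivatives because signals
may have corners at triggering times. In the error coordinates (`hasDerivWithinAt_z`) the control
supplies `-k₁ [z]^(2q-1)`. The term `-k₂ [z]^(2p-1)` appears because its opposite belongs to the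
lumped function that the network represents. Multiplying by `z i` and summing, the couplings `z i *
z (i+1)` telescope, Young's inequality bounds the network terms, and the adaptive law cancels what
depends on the unknown weights. The triggering enters only through `z_mul_g_le`: up to a multiple of
`Φ`, the sampled input acts on `z n` at least as well as `alphaN`, because `|x| - x tanh x ≤
0.2785`. The outcome is `derivWithin_V_le`, whose decay consists of `q`-th and `p`-th powers of `z i
^ 2 / 2` and a linear term in the squared estimation errors.

This inequality is used twice. Since `a ≤ a^q + a^p`, it implies linear decay of `V` up to a
constant, so `V` stays bounded (`IsSolution.V_le`); with bounded neurons, all signals are then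
bounded. Once the estimation errors have bounds `γ`, the linear term can be traded for powers at the
cost of constants, which gives `V' ≤ -a V^q - b V^p + c` (`derivWithin_V_le_fixed_time`). The
comparison lemma `le_residual_of_fixed_time` then yields the settling time: above the residual level
the `q`-power brings `V` below 1 in a time independent of `V 0`, and the `p`-power finishes in
finite time. Tracking in the original coordinates follows because the inverse of the logarithmic map
is Lipschitz. -/

lemma sig_zero (r : ℝ) : sig r 0 = 0 := by simp [sig]

lemma sig_of_pos {r z : ℝ} (hz : 0 < z) : sig r z = z ^ r := by
  simp [sig, Real.sign_of_pos hz, abs_of_pos hz]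

lemma sig_of_neg {r z : ℝ} (hz : z < 0) : sig r z = -(-z) ^ r := by
  simp [sig, Real.sign_of_neg hz, abs_of_neg hz]

lemma abs_sig_le (r z : ℝ) : |sig r z| ≤ |z| ^ r := by
  have h : 0 ≤ |z| ^ r := Real.rpow_nonneg (abs_nonneg z) r
  rcases lt_trichotomy z 0 with hz | rfl | hz
  · rw [sig_of_neg hz, abs_neg, ← abs_of_neg hz, abs_of_nonneg h]
  · simpa [sig_zero] using h
  · rw [sig_of_pos hz, abs_of_pos hz, abs_of_nonneg (by positivity)]

lemma mul_sig {r : ℝ} (hr : 0 < r + 1) (z : ℝ) : z * sig r z = |z| ^ (r + 1) := by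
  rcases lt_trichotomy z 0 with hz | rfl | hz
  · rw [sig_of_neg hz, abs_of_neg hz, Real.rpow_add_one (by linarith)]; ring
  · rw [sig_zero, abs_zero, Real.zero_rpow hr.ne']; ring
  · rw [sig_of_pos hz, abs_of_pos hz, Real.rpow_add_one hz.ne']; ring

/-- The exponent `2s-1` makes the feedback produce a power of the Lyapunov summand `z²/2`; the
factor `2^s` is the one appearing in `gainMin`. -/
lemma mul_sig_two_mul_sub_one {s : ℝ} (hs : 0 < s) (z : ℝ) :
    z * sig (2 * s - 1) z = 2 ^ s * (z ^ 2 / 2) ^ s := by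
  rw [mul_sig (by linarith), ← Real.mul_rpow (by norm_num) (by positivity),
    show 2 * (z ^ 2 / 2) = |z| ^ (2 : ℝ) by rw [Real.rpow_two, sq_abs]; ring,
    ← Real.rpow_mul (abs_nonneg z)]
  congr 1; ring

/-- At the origin the derivative is 0 by domination by `|z|^r`; elsewhere `sig r` is locally a
smooth power. It is applied with `r = 2q-1`, the exponent inside the control laws. -/
lemma differentiableAt_sig {r : ℝ} (hr : 1 < r) (z : ℝ) : DifferentiableAt ℝ (sig r) z := by
  rcases lt_trichotomy z 0 with hz | rfl | hz
  · have h : DifferentiableAt ℝ (fun y : ℝ => -(-y) ^ r) z :=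
      ((differentiableAt_id.neg).rpow_const (Or.inl (by simpa using hz.ne))).neg
    refine h.congr_of_eventuallyEq ?_
    filter_upwards [Iio_mem_nhds hz] with y hy using sig_of_neg hy
  · have h : HasDerivAt (fun x : ℝ => |x| ^ r) 0 0 := by
      simpa using hasDerivAt_abs_rpow 0 hr
    refine HasDerivAt.differentiableAt (f' := 0) ?_
    rw [hasDerivAt_iff_isLittleO] at h ⊢
    refine Asymptotics.IsBigO.trans_isLittleO ?_ h
    refine Asymptotics.IsBigO.of_bound 1 (Eventually.of_forall fun y => ?_)
    simp only [sig_zero, smul_zero, sub_zero, abs_zero, Real.zero_rpow (by linarith : r ≠ 0),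
      one_mul, Real.norm_eq_abs]
    exact (abs_sig_le r y).trans (le_abs_self _)
  · have h : DifferentiableAt ℝ (fun y : ℝ => y ^ r) z :=
      differentiableAt_id.rpow_const (Or.inl hz.ne')
    refine h.congr_of_eventuallyEq ?_
    filter_upwards [Ioi_mem_nhds hz] with y hy using sig_of_pos hy

/-! ### The hyperbolic tangent -/

lemma differentiable_tanh : Differentiable ℝ Real.tanh := by
  have : Real.tanh = fun x => Real.sinh x / Real.cosh x := funext Real.tanh_eq_sinh_div_cosh
  rw [this]
  exact Real.differentiable_sinh.div Real.differentiable_cosh fun x => (Real.cosh_pos x).ne'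

lemma abs_tanh_le_one (x : ℝ) : |Real.tanh x| ≤ 1 := by
  rw [abs_le]
  exact ⟨(Real.neg_one_lt_tanh x).le, (Real.tanh_lt_one x).le⟩

lemma one_sub_tanh (x : ℝ) : 1 - Real.tanh x = 2 / (Real.exp (2 * x) + 1) := by
  have h : Real.exp (2 * x) = Real.exp x * Real.exp x := by rw [← Real.exp_add]; ring_nf
  have h1 := Real.exp_pos x
  rw [Real.tanh_eq_sinh_div_cosh, Real.sinh_eq, Real.cosh_eq, Real.exp_neg, h]
  field_simp
  ring

/-- The tangent to `exp` at `1.2785` gives `exp y ≥ exp 1.2785 * (y - 0.2785)`, and `0.2785 * exp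
1.2785 ≥ 1`. The constant is a rounded-up solution of `κ = exp (-(κ+1))`. -/
lemma le_exp_add_one (y : ℝ) : y ≤ 0.2785 * (Real.exp y + 1) := by
  have e1 : 1 / 0.2785 ≤ Real.exp 1.2785 := by
    rw [show (1.2785 : ℝ) = 1 + 0.2785 by norm_num, Real.exp_add]
    have a := Real.exp_one_gt_d9
    have b : (1.3211 : ℝ) ≤ Real.exp 0.2785 := by
      have := Real.sum_le_exp_of_nonneg (x := 0.2785) (by norm_num) 5
      refine le_trans ?_ this
      norm_num [Finset.sum_range_succ, Nat.factorial]
    have := mul_le_mul a.le b (by norm_num) (by positivity)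
    refine le_trans ?_ this
    norm_num
  rcases le_total (y - 0.2785) 0 with h | h
  · have := Real.exp_pos y
    nlinarith
  · have e2 : Real.exp y = Real.exp 1.2785 * Real.exp (y - 1.2785) := by
      rw [← Real.exp_add]; ring_nf
    have e3 := Real.add_one_le_exp (y - 1.2785)
    have e4 := mul_le_mul e1 (show y - 0.2785 ≤ Real.exp (y - 1.2785) by linarith) h
      (Real.exp_pos _).le
    rw [← e2] at e4
    have e5 : 0.2785 * (1 / 0.2785 * (y - 0.2785)) = y - 0.2785 := by ring
    nlinarith

lemma abs_sub_mul_tanh_le (x : ℝ) : |x| - x * Real.tanh x ≤ 0.2785 := by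
  have key : ∀ y : ℝ, y - y * Real.tanh y ≤ 0.2785 := by
    intro y
    have h := le_exp_add_one (2 * y)
    have h2 : y - y * Real.tanh y = 2 * y / (Real.exp (2 * y) + 1) := by
      rw [← mul_one_sub, one_sub_tanh]; ring
    rw [h2, div_le_iff₀ (by positivity)]
    exact h
  rcases le_total 0 x with h | h
  · rw [abs_of_nonneg h]; exact key x
  · rw [abs_of_nonpos h]
    have := key (-x)
    rw [Real.tanh_neg] at this
    linarith

lemma abs_sub_mul_tanh_div_le {Φ : ℝ} (hΦ : 0 < Φ) (x v : ℝ) :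
    |x * v| - x * (v * Real.tanh (x * v / Φ)) ≤ 0.2785 * Φ := by
  have h := mul_le_mul_of_nonneg_right (abs_sub_mul_tanh_le (x * v / Φ)) hΦ.le
  refine le_trans (le_of_eq ?_) h
  rw [abs_div, abs_of_pos hΦ]
  field_simp

lemma mul_tanh_nonneg (x : ℝ) : 0 ≤ x * Real.tanh x := by
  rw [Real.tanh_eq_sinh_div_cosh, ← mul_div_assoc]
  refine div_nonneg ?_ (Real.cosh_pos x).le
  rcases le_total 0 x with h | h
  · exact mul_nonneg h (Real.sinh_nonneg_iff.2 h)
  · exact mul_nonneg_of_nonpos_of_nonpos h (Real.sinh_nonpos_iff.2 h)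

lemma mul_mul_tanh_div_nonneg {Φ : ℝ} (hΦ : 0 < Φ) (x v : ℝ) :
    0 ≤ x * (v * Real.tanh (x * v / Φ)) := by
  have h := mul_nonneg (mul_tanh_nonneg (x * v / Φ)) hΦ.le
  refine h.trans (le_of_eq ?_)
  field_simp

/-! ### Right derivatives -/

/-- At a zero of `f` the norm may have a corner, but from the right it grows like `(s - t) ‖v‖`.
This handles neurons `exp (-‖W - μ‖ / D)` when the input passes through a center. -/
lemma differentiableWithinAt_norm_Ici {E : Type*} [NormedAddCommGroup E] [InnerProductSpace ℝ E]
    {f : ℝ → E} {t : ℝ} (hf : DifferentiableWithinAt ℝ f (Ici t) t) :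
    DifferentiableWithinAt ℝ (fun s => ‖f s‖) (Ici t) t := by
  by_cases h0 : f t = 0
  · have hd := hf.hasDerivWithinAt
    set v := derivWithin f (Ici t) t
    refine HasDerivWithinAt.differentiableWithinAt (f' := ‖v‖) ?_
    rw [hasDerivWithinAt_iff_isLittleO] at hd ⊢
    refine Asymptotics.IsBigO.trans_isLittleO ?_ hd
    refine Asymptotics.IsBigO.of_bound 1 ?_
    filter_upwards [self_mem_nhdsWithin] with s hs
    have hs' : 0 ≤ s - t := sub_nonneg.2 hs
    have h1 : (s - t) • ‖v‖ = ‖(s - t) • v‖ := by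
      rw [norm_smul, Real.norm_of_nonneg hs', smul_eq_mul]
    rw [h0, norm_zero, sub_zero, sub_zero, one_mul, h1]
    exact abs_norm_sub_norm_le _ _
  · exact hf.norm ℝ h0

/-! ### Scalar differential inequalities -/

lemma nonincreasing_of_right_deriv_nonpos {f f' : ℝ → ℝ} {a b : ℝ} (hab : a ≤ b)
    (hf : ContinuousOn f (Icc a b))
    (hf' : ∀ x ∈ Ico a b, HasDerivWithinAt f (f' x) (Ici x) x) (h : ∀ x ∈ Ico a b, f' x ≤ 0) :
    f b ≤ f a :=
  image_le_of_deriv_right_le_deriv_boundary (B := fun _ => f a) hf hf' le_rfl continuousOn_const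
    (fun x _ => hasDerivWithinAt_const x _ (f a)) h (right_mem_Icc.2 hab)

/-- A sublevel set is invariant if the right derivative is negative above the level. -/
lemma le_of_right_deriv_neg_above {f f' : ℝ → ℝ} {a b K : ℝ} (hab : a ≤ b)
    (hf : ContinuousOn f (Icc a b))
    (hf' : ∀ x ∈ Ico a b, HasDerivWithinAt f (f' x) (Ici x) x)
    (h : ∀ x ∈ Ico a b, K < f x → f' x < 0) (ha : f a ≤ K) : f b ≤ K := by
  -- The sign of `f'` is known only strictly above `K`, so barriers at levels `L > K` are used.
  refine le_of_forall_gt_imp_ge_of_dense fun L hL => ?_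
  refine image_le_of_deriv_right_lt_deriv_boundary' hf hf' (ha.trans hL.le) continuousOn_const
    (fun x _ => hasDerivWithinAt_const x _ L) (fun x hx hxL => ?_) (right_mem_Icc.2 hab)
  exact h x hx (by simpa [hxL] using hL)

lemma hasDerivWithinAt_rpow_const {f : ℝ → ℝ} {f' t r : ℝ} {s : Set ℝ}
    (hf : HasDerivWithinAt f f' s t) (ht : 0 < f t) :
    HasDerivWithinAt (fun x => f x ^ r) (f' * r * f t ^ (r - 1)) s t :=
  hf.rpow_const (Or.inl ht.ne')

/-- Fixed-time convergence: a positive function with `f' ≤ -A f^q` and `f' ≤ -B f^p` cannot exist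
up to the time `1/(A(q-1)) + 1/(B(1-p))`. -/
lemma lt_of_fixed_time_decay {f f' : ℝ → ℝ} {A B p q t : ℝ} (hA : 0 < A) (hB : 0 < B)
    (hp : p < 1) (hq : 1 < q) (hf : ContinuousOn f (Icc 0 t))
    (hf' : ∀ x ∈ Ico 0 t, HasDerivWithinAt f (f' x) (Ici x) x)
    (hpos : ∀ x ∈ Icc 0 t, 0 < f x) (hfq : ∀ x ∈ Ico 0 t, f' x ≤ -(A * f x ^ q))
    (hfp : ∀ x ∈ Ico 0 t, f' x ≤ -(B * f x ^ p)) :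
    t < 1 / (A * (q - 1)) + 1 / (B * (1 - p)) := by
  by_contra! ht
  set t₁ := 1 / (A * (q - 1)) with ht₁
  have hq' : 0 < q - 1 := by linarith
  have hp' : 0 < 1 - p := by linarith
  have h1 : 0 < t₁ := by positivity
  have h2 : 0 < 1 / (B * (1 - p)) := by positivity
  have h1t : t₁ ≤ t := by linarith
  have hpw : ∀ r : ℝ, ContinuousOn (fun x => f x ^ r) (Icc 0 t) := fun r =>
    hf.rpow_const fun x hx => Or.inl (hpos x hx).ne'
  -- `f^(1-q)` grows at rate at least `A(q-1)` from a positive value, so it exceeds 1 at `t₁`,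
  -- whatever `f 0` is.
  have step1 : 1 < f t₁ ^ (1 - q) := by
    have hsub : Icc 0 t₁ ⊆ Icc 0 t := Icc_subset_Icc_right h1t
    have := nonincreasing_of_right_deriv_nonpos (f := fun x => A * (q - 1) * x - f x ^ (1 - q))
      (f' := fun x => A * (q - 1) * 1 - f' x * (1 - q) * f x ^ (1 - q - 1)) h1.le
      (((continuous_const.mul continuous_id).continuousOn).sub ((hpw _).mono hsub))
      (fun x hx => ((hasDerivWithinAt_id x _).const_mul _).sub
        (hasDerivWithinAt_rpow_const (hf' x ⟨hx.1, hx.2.trans_le h1t⟩)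
          (hpos x ⟨hx.1, hx.2.le.trans h1t⟩)))
      (fun x hx => by
        have hx0 := hpos x ⟨hx.1, hx.2.le.trans h1t⟩
        have e : f x ^ q * f x ^ (1 - q - 1) = 1 := by
          rw [← Real.rpow_add hx0, show q + (1 - q - 1) = 0 by ring, Real.rpow_zero]
        have e1 := hfq x ⟨hx.1, hx.2.trans_le h1t⟩
        have e2 := mul_le_mul_of_nonneg_right e1
          (show 0 ≤ (q - 1) * f x ^ (1 - q - 1) by positivity)
        have e3 : -(A * f x ^ q) * ((q - 1) * f x ^ (1 - q - 1)) = -(A * (q - 1)) := by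
          linear_combination (-(A * (q - 1))) * e
        rw [e3] at e2
        linarith)
    have e : A * (q - 1) * t₁ = 1 := by rw [ht₁]; field_simp
    have e0 : 0 < f 0 ^ (1 - q) := Real.rpow_pos_of_pos (hpos 0 ⟨le_rfl, h1.le.trans h1t⟩) _
    simp only [e, mul_zero] at this
    linarith
  have step2 : f t₁ < 1 := by
    by_contra! hc
    exact absurd (Real.rpow_le_one_of_one_le_of_nonpos hc (by linarith)) (not_le.2 step1)
  have step3 : f t₁ ^ (1 - p) < 1 :=
    Real.rpow_lt_one (hpos t₁ ⟨h1.le, h1t⟩).le step2 hp'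
  -- From a value below 1, `f^(1-p)` falls at rate at least `B(1-p)` and would be negative at `t`.
  have step4 := nonincreasing_of_right_deriv_nonpos
      (f := fun x => f x ^ (1 - p) + B * (1 - p) * x)
      (f' := fun x => f' x * (1 - p) * f x ^ (1 - p - 1) + B * (1 - p) * 1) h1t
      (((hpw _).mono (Icc_subset_Icc_left h1.le)).add
        ((continuous_const.mul continuous_id).continuousOn))
      (fun x hx => (hasDerivWithinAt_rpow_const (hf' x ⟨h1.le.trans hx.1, hx.2⟩)
          (hpos x ⟨h1.le.trans hx.1, hx.2.le⟩)).add ((hasDerivWithinAt_id x _).const_mul _))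
      (fun x hx => by
        have hx0 := hpos x ⟨h1.le.trans hx.1, hx.2.le⟩
        have e : f x ^ p * f x ^ (1 - p - 1) = 1 := by
          rw [← Real.rpow_add hx0, show p + (1 - p - 1) = 0 by ring, Real.rpow_zero]
        have e1 := hfp x ⟨h1.le.trans hx.1, hx.2⟩
        have e2 := mul_le_mul_of_nonneg_right e1
          (show 0 ≤ (1 - p) * f x ^ (1 - p - 1) by positivity)
        have e3 : -(B * f x ^ p) * ((1 - p) * f x ^ (1 - p - 1)) = -(B * (1 - p)) := by
          linear_combination (-(B * (1 - p))) * e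
        rw [e3] at e2
        linarith)
  have e : 1 ≤ B * (1 - p) * (t - t₁) := by
    have := mul_le_mul_of_nonneg_left (show 1 / (B * (1 - p)) ≤ t - t₁ by linarith)
      (show 0 ≤ B * (1 - p) by positivity)
    rwa [mul_one_div_cancel (by positivity)] at this
  have e0 : 0 < f t ^ (1 - p) :=
    Real.rpow_pos_of_pos (hpos t ⟨h1.le.trans h1t, le_rfl⟩) _
  linarith

/-- A solution of `f' ≤ -A f^q - B f^p + c` is below the smaller residual level after the settling
time. -/
lemma le_residual_of_fixed_time {f f' : ℝ → ℝ} {A B c p q I t : ℝ} (hA : 0 < A) (hB : 0 < B)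
    (hc : 0 < c) (hp0 : 0 < p) (hp : p < 1) (hq : 1 < q) (hI0 : 0 < I) (hI1 : I < 1)
    (hf : ContinuousOn f (Icc 0 t))
    (hf' : ∀ x ∈ Ico 0 t, HasDerivWithinAt f (f' x) (Ici x) x)
    (hfb : ∀ x ∈ Ico 0 t, f' x ≤ -(A * f x ^ q) - B * f x ^ p + c)
    (ht : 1 / (A * I * (q - 1)) + 1 / (B * I * (1 - p)) ≤ t) :
    f t ≤ min ((c / ((1 - I) * A)) ^ (1 / q)) ((c / ((1 - I) * B)) ^ (1 / p)) := by
  set K := min ((c / ((1 - I) * A)) ^ (1 / q)) ((c / ((1 - I) * B)) ^ (1 / p)) with hK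
  have hI' : 0 < 1 - I := by linarith
  have hK0 : 0 < K := lt_min (by positivity) (by positivity)
  have hq0 : 0 < q := by linarith
  -- Exceeding the minimum means exceeding one of the two levels; the share `1 - I` of that power
  -- term alone absorbs `c`.
  have above : ∀ x ∈ Ico 0 t, K < f x → f' x ≤ -(A * I * f x ^ q) - B * I * f x ^ p := by
    intro x hx hKx
    have hfx : 0 < f x := hK0.trans hKx
    have n1 : 0 ≤ (1 - I) * A * f x ^ q := by positivity
    have n2 : 0 ≤ (1 - I) * B * f x ^ p := by positivity
    have : c ≤ (1 - I) * A * f x ^ q ∨ c ≤ (1 - I) * B * f x ^ p := by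
      have lev : ∀ (D r : ℝ), 0 < D → 0 < r → (c / ((1 - I) * D)) ^ (1 / r) < f x →
          c ≤ (1 - I) * D * f x ^ r := by
        intro D r hD hr h
        have := Real.rpow_le_rpow (by positivity) h.le hr.le
        rw [← Real.rpow_mul (by positivity), one_div_mul_cancel hr.ne', Real.rpow_one,
          div_le_iff₀ (by positivity)] at this
        linarith
      rcases min_lt_iff.1 hKx with h | h
      · exact Or.inl (lev A q hA hq0 h)
      · exact Or.inr (lev B p hB hp0 h)
    have := hfb x hx
    rcases ‹_ ∨ _› with h | h <;> nlinarith
  have t0 : 0 ≤ t := le_trans (by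
    have : 0 < q - 1 := by linarith
    have : 0 < 1 - p := by linarith
    positivity) ht
  by_contra! hcon
  -- The sublevel set of `K` is invariant, so a value above `K` at `t` forces values above `K` at
  -- all earlier times.
  have hall : ∀ x ∈ Icc 0 t, K < f x := by
    intro x hx
    by_contra! hxK
    refine absurd (le_of_right_deriv_neg_above hx.2 (hf.mono (Icc_subset_Icc_left hx.1))
      (fun y hy => hf' y ⟨hx.1.trans hy.1, hy.2⟩) (fun y hy hKy => ?_) hxK) (not_le.2 hcon)
    have hfy : 0 < f y := hK0.trans hKy
    have n1 : 0 < A * I * f y ^ q := by positivity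
    have n2 : 0 < B * I * f y ^ p := by positivity
    linarith [above y ⟨hx.1.trans hy.1, hy.2⟩ hKy]
  refine absurd (lt_of_fixed_time_decay (A := A * I) (B := B * I) (by positivity) (by positivity)
    hp hq hf hf' (fun x hx => hK0.trans (hall x hx)) (fun x hx => ?_) (fun x hx => ?_))
    (not_lt.2 ht)
  all_goals
    have hKx := hall x ⟨hx.1, hx.2.le⟩
    have hfx : 0 < f x := hK0.trans hKx
    have n1 : 0 < A * I * f x ^ q := by positivity
    have n2 : 0 < B * I * f x ^ p := by positivity
    linarith [above x hx hKx]

/-! ### Power inequalities -/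

lemma le_rpow_add_rpow {p q a : ℝ} (hp : 0 < p) (hp1 : p < 1) (hq : 1 < q) (ha : 0 ≤ a) :
    a ≤ a ^ q + a ^ p := by
  have n1 : 0 ≤ a ^ q := by positivity
  have n2 : 0 ≤ a ^ p := by positivity
  rcases le_total a 1 with h | h
  · have := Real.rpow_le_rpow_of_exponent_ge' ha h hp.le hp1.le
    rw [Real.rpow_one] at this
    linarith
  · have := Real.rpow_le_rpow_of_exponent_le h hq.le
    rw [Real.rpow_one] at this
    linarith

/-- Weighted AM-GM with weights `p`, `1-p` for `b/p` and `p^(p/(1-p))`, whose geometric mean is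
`b^p`. -/
lemma rpow_le_add_const {p b : ℝ} (hp : 0 < p) (hp1 : p < 1) (hb : 0 ≤ b) :
    b ^ p ≤ b + (1 - p) * p ^ (p / (1 - p)) := by
  have hp' : 0 < 1 - p := by linarith
  have h := Real.geom_mean_le_arith_mean2_weighted hp.le hp'.le
    (show 0 ≤ b / p by positivity) (show 0 ≤ p ^ (p / (1 - p)) by positivity) (by ring)
  rw [← Real.rpow_mul hp.le, div_mul_cancel₀ _ hp'.ne', ← Real.mul_rpow (by positivity) hp.le,
    div_mul_cancel₀ _ hp.ne', mul_div_cancel₀ _ hp.ne'] at h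
  exact h

lemma rpow_sum_le_sum_rpow {ι : Type*} (s : Finset ι) (f : ι → ℝ) {p : ℝ} (hp : 0 < p)
    (hp1 : p ≤ 1) (hf : ∀ i ∈ s, 0 ≤ f i) : (∑ i ∈ s, f i) ^ p ≤ ∑ i ∈ s, f i ^ p := by
  classical
  induction s using Finset.induction_on with
  | empty => simp [Real.zero_rpow hp.ne']
  | insert a s ha ih =>
    rw [Finset.sum_insert ha, Finset.sum_insert ha]
    refine (Real.rpow_add_le_add_rpow (hf a (by simp))
      (Finset.sum_nonneg fun i hi => hf i (by simp [hi])) hp.le hp1).trans ?_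
    gcongr
    exact ih fun i hi => hf i (by simp [hi])

lemma rpow_sum_add_le {n : ℕ} (f : ℕ → ℝ) (hf : ∀ i, 0 ≤ f i) {b q : ℝ} (hb : 0 ≤ b)
    (hq : 1 ≤ q) : (∑ i ∈ Finset.Icc 1 n, f i + b) ^ q ≤
      ((n : ℝ) + 1) ^ (q - 1) * (∑ i ∈ Finset.Icc 1 n, f i ^ q + b ^ q) := by
  -- The extra summand `b` is placed at the free index 0, giving `n + 1` terms for the power mean
  -- inequality.
  have h := Real.rpow_sum_le_const_mul_sum_rpow_of_nonneg (Finset.Icc 0 n)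
    (f := fun i => if i = 0 then b else f i) hq (fun i _ => by split_ifs <;> simp [*])
  have e : ∀ F : ℕ → ℝ, ∑ i ∈ Finset.Icc 0 n, F i = ∑ i ∈ Finset.Icc 1 n, F i + F 0 := by
    intro F
    rw [← Finset.insert_Icc_succ_left_eq_Icc (Nat.zero_le n), Finset.sum_insert (by simp), add_comm]
    rfl
  rw [e, e] at h
  have e2 : ∀ G : ℝ → ℝ, ∑ i ∈ Finset.Icc 1 n, G (if i = 0 then b else f i) =
      ∑ i ∈ Finset.Icc 1 n, G (f i) := fun G =>
    Finset.sum_congr rfl fun i hi => by rw [if_neg (by have := (Finset.mem_Icc.1 hi).1; omega)]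
  rw [e2 (fun x => x), e2 (fun x => x ^ q)] at h
  simpa using h

/-! ### Continuity and right differentiability of the closed-loop signals -/

section Regularity

/-- Signals on `[0, T)` that are continuous and have a right derivative everywhere. -/
def RightRegular {E : Type*} [NormedAddCommGroup E] [NormedSpace ℝ E] (T : EReal) (f : ℝ → E) :
    Prop :=
  ContinuousOn f {t : ℝ | 0 ≤ t ∧ (t : EReal) < T} ∧
    ∀ t : ℝ, 0 ≤ t → (t : EReal) < T → DifferentiableWithinAt ℝ f (Ici t) t

namespace RightRegular

variable {T : EReal} {f g : ℝ → ℝ}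

lemma const (c : ℝ) : RightRegular T fun _ => c :=
  ⟨continuousOn_const, fun _ _ _ => differentiableWithinAt_const c⟩

lemma add (hf : RightRegular T f) (hg : RightRegular T g) : RightRegular T fun t => f t + g t :=
  ⟨hf.1.add hg.1, fun t h0 hT => (hf.2 t h0 hT).add (hg.2 t h0 hT)⟩

lemma sub (hf : RightRegular T f) (hg : RightRegular T g) : RightRegular T fun t => f t - g t :=
  ⟨hf.1.sub hg.1, fun t h0 hT => (hf.2 t h0 hT).sub (hg.2 t h0 hT)⟩

lemma mul (hf : RightRegular T f) (hg : RightRegular T g) : RightRegular T fun t => f t * g t :=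
  ⟨hf.1.mul hg.1, fun t h0 hT => (hf.2 t h0 hT).mul (hg.2 t h0 hT)⟩

lemma comp {φ : ℝ → ℝ} (hf : RightRegular T f)
    (hφ : ∀ t : ℝ, 0 ≤ t → (t : EReal) < T → DifferentiableAt ℝ φ (f t)) :
    RightRegular T fun t => φ (f t) :=
  ⟨fun t ht => (hφ t ht.1 ht.2).continuousAt.comp_continuousWithinAt (hf.1 t ht),
    fun t h0 hT => (hφ t h0 hT).comp_differentiableWithinAt t (hf.2 t h0 hT)⟩

lemma of_differentiableAt (hf : ∀ t : ℝ, 0 ≤ t → DifferentiableAt ℝ f t) : RightRegular T f :=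
  ⟨fun t ht => (hf t ht.1).continuousAt.continuousWithinAt,
    fun t h0 _ => (hf t h0).differentiableWithinAt⟩

lemma pow (hf : RightRegular T f) (k : ℕ) : RightRegular T fun t => f t ^ k :=
  hf.comp fun _ _ _ => differentiableAt_pow k

lemma congr (hf : RightRegular T f) (h : ∀ t, g t = f t) : RightRegular T g := by
  rwa [show g = f from funext h]

lemma sum {ι : Type*} {s : Finset ι} {F : ι → ℝ → ℝ} (hF : ∀ i ∈ s, RightRegular T (F i)) :
    RightRegular T fun t => ∑ i ∈ s, F i t :=
  ⟨continuousOn_finsetSum s fun i hi => (hF i hi).1,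
    fun t h0 hT => DifferentiableWithinAt.fun_sum fun i hi => (hF i hi).2 t h0 hT⟩

lemma toLp {ι : Type*} [Fintype ι] {F : ι → ℝ → ℝ} (hF : ∀ i, RightRegular T (F i)) :
    RightRegular T fun t => (WithLp.toLp 2 fun i => F i t : EuclideanSpace ℝ ι) :=
  ⟨(PiLp.continuous_toLp 2 _).comp_continuousOn (continuousOn_pi.2 fun i => (hF i).1),
    fun t h0 hT => differentiableWithinAt_euclidean.2 fun i => (hF i).2 t h0 hT⟩

lemma norm {E : Type*} [NormedAddCommGroup E] [InnerProductSpace ℝ E] {F : ℝ → E}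
    (hF : RightRegular T F) : RightRegular T fun t => ‖F t‖ :=
  ⟨hF.1.norm, fun t h0 hT => differentiableWithinAt_norm_Ici (hF.2 t h0 hT)⟩

lemma sub_const {E : Type*} [NormedAddCommGroup E] [NormedSpace ℝ E] {F : ℝ → E}
    (hF : RightRegular T F) (c : E) : RightRegular T fun t => F t - c :=
  ⟨hF.1.sub continuousOn_const, fun t h0 hT => (hF.2 t h0 hT).sub_const c⟩

lemma continuousOn_Icc {E : Type*} [NormedAddCommGroup E] [NormedSpace ℝ E] {F : ℝ → E}
    (hF : RightRegular T F) {a b : ℝ} (ha : 0 ≤ a) (hb : (b : EReal) < T) :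
    ContinuousOn F (Icc a b) :=
  hF.1.mono fun _ ht => ⟨ha.trans ht.1, (EReal.coe_le_coe_iff.2 ht.2).trans_lt hb⟩

end RightRegular

variable {n : ℕ} {P : Plant n} {C : Controller n} {xr : ℝ → ℝ} {S : Signals} {s : Scheme}
  {T : EReal} {tk : ℕ → EReal} {law : ℕ → Law}

/-! ### The logarithmic transformation -/

/-- For `r = (a+x)/(b-x)` one has `r + 1/r + 2 = (a+b)²/((a+x)(b-x))`, which expresses the
derivative through the transformed variable. -/
lemma hasDerivAt_log_div {a b x : ℝ} (h1 : 0 < a + x) (h2 : 0 < b - x) :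
    HasDerivAt (fun x => Real.log ((a + x) / (b - x)))
      ((Real.exp (Real.log ((a + x) / (b - x))) + Real.exp (-Real.log ((a + x) / (b - x))) + 2)
        / (a + b)) x := by
  have h := (((hasDerivAt_id x).const_add a).div ((hasDerivAt_id x).const_sub b) h2.ne').log
    (div_pos h1 h2).ne'
  refine h.congr_deriv ?_
  have h3 : 0 < a + b := by linarith
  rw [Real.exp_neg, Real.exp_log (div_pos h1 h2)]
  simp only [id, Pi.div_apply]
  field_simp
  ring

lemma contDiffAt_iteratedDeriv {f : ℝ → ℝ} {t : ℝ} (hf : ContDiffAt ℝ ∞ f t) (j : ℕ) :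
    ContDiffAt ℝ ∞ (iteratedDeriv j f) t := by
  rw [iteratedDeriv_eq_equiv_comp]
  exact (LinearIsometryEquiv.contDiff _).contDiffAt.comp t
    (hf.iteratedFDeriv_right (m := ∞) (by exact_mod_cast le_top))

lemma contDiffAt_ws (hxr : AdmissibleReference P xr) {t : ℝ} (ht : 0 ≤ t) :
    ContDiffAt ℝ ∞ (ws P xr) t := by
  obtain ⟨h, ⟨η, hη, hb⟩, -⟩ := hxr
  obtain ⟨h1, h2⟩ := hb t ht
  have h3 : 0 < P.ρ₂ 1 - xr t := by linarith
  have h4 : 0 < P.ρ₁ 1 + xr t := by linarith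
  exact ((contDiffAt_const.add h.contDiffAt).div (contDiffAt_const.sub h.contDiffAt) h3.ne').log
    (div_pos h4 h3).ne'

lemma rightRegular_iteratedDeriv_ws (hxr : AdmissibleReference P xr) (j : ℕ) :
    RightRegular T (iteratedDeriv j (ws P xr)) :=
  .of_differentiableAt fun _ ht =>
    (contDiffAt_iteratedDeriv (contDiffAt_ws hxr ht) j).differentiableAt (by simp)

lemma hasDerivAt_ws (hxr : AdmissibleReference P xr) {t : ℝ} (ht : 0 ≤ t) :
    HasDerivAt (ws P xr) (Delta P 1 (ws P xr t) * deriv xr t) t := by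
  obtain ⟨h, ⟨η, hη, hb⟩, -⟩ := hxr
  obtain ⟨h1, h2⟩ := hb t ht
  exact (hasDerivAt_log_div (a := P.ρ₁ 1) (b := P.ρ₂ 1) (x := xr t) (by linarith)
    (by linarith)).comp t ((h.differentiable (by simp)) t).hasDerivAt

namespace IsSolution

variable (hS : IsSolution P C xr S s T tk law)

include hS

lemma hasDerivWithinAt_w {i : ℕ} (h1 : 1 ≤ i) (hi : i ≤ n) {t : ℝ} (h0 : 0 ≤ t)
    (hT : (t : EReal) < T) {v : ℝ} (hv : HasDerivWithinAt (S.x i) v (Ici t) t) :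
    HasDerivWithinAt (w P S i) (Delta P i (w P S i t) * v) (Ici t) t := by
  obtain ⟨a, b⟩ := hS.x_mem i h1 hi t h0 hT
  exact (hasDerivAt_log_div (a := P.ρ₁ i) (b := P.ρ₂ i) (by linarith)
    (by linarith)).comp_hasDerivWithinAt t hv

lemma rightRegular_x {i : ℕ} (h1 : 1 ≤ i) (hi : i ≤ n) : RightRegular T (S.x i) := by
  refine ⟨hS.x_cont i h1 hi, fun t h0 hT => ?_⟩
  rcases hi.lt_or_eq with h | rfl
  · exact (hS.x_eq i h1 h t h0 hT).differentiableWithinAt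
  · exact (hS.xn_eq t h0 hT).differentiableWithinAt

lemma rightRegular_φhat {i : ℕ} (h1 : 1 ≤ i) (hi : i ≤ n) : RightRegular T (S.φhat i) :=
  ⟨hS.φ_cont i h1 hi, fun t h0 hT => (hS.φ_eq i h1 hi t h0 hT).differentiableWithinAt⟩

lemma rightRegular_w {i : ℕ} (h1 : 1 ≤ i) (hi : i ≤ n) : RightRegular T (w P S i) :=
  (hS.rightRegular_x h1 hi).comp (φ := fun x => Real.log ((P.ρ₁ i + x) / (P.ρ₂ i - x)))
    fun t h0 hT => by
      obtain ⟨a, b⟩ := hS.x_mem i h1 hi t h0 hT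
      exact (hasDerivAt_log_div (by linarith) (by linarith)).differentiableAt

variable (hxr : AdmissibleReference P xr)
include hxr

lemma rightRegular_Z {i : ℕ} (hi : i ≤ n) : RightRegular T (Z P xr S i) := by
  refine (RightRegular.toLp (ι := Fin i ⊕ Fin (i - 1) ⊕ Fin (i + 1))
    (F := fun k t => Z P xr S i t k) ?_)
  rintro (j | j | j)
  · exact hS.rightRegular_w (i := (j : ℕ) + 1) (by omega) (by omega)
  · exact hS.rightRegular_φhat (i := (j : ℕ) + 1) (by omega) (by omega)
  · exact rightRegular_iteratedDeriv_ws hxr j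

lemma rightRegular_basis {i : ℕ} (hi : i ≤ n) :
    RightRegular T fun t => basis C i (Z P xr S i t) := by
  refine RightRegular.toLp fun l => RightRegular.comp (φ := fun r => Real.exp (-r / C.width i))
    ((hS.rightRegular_Z hxr hi).sub_const (C.center i l)).norm fun t _ _ => ?_
  exact ((differentiableAt_id.neg).div_const _).exp

lemma rightRegular_feedback {i : ℕ} (h1 : 1 ≤ i) (hi : i ≤ n) {ζ : ℝ → ℝ}
    (hζ : RightRegular T ζ) : RightRegular T fun t =>
      -C.k₁ i * sig (2 * C.q - 1) (ζ t) - 1 / (2 * C.u i ^ 2) * ζ t * S.φhat i t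
        * ‖basis C i (Z P xr S i t)‖ ^ 2 := by
  have hq := C.q_gt
  exact ((RightRegular.const _).mul (hζ.comp fun t _ _ => differentiableAt_sig (by linarith) _)).sub
    ((((RightRegular.const _).mul hζ).mul (hS.rightRegular_φhat h1 hi)).mul
      ((hS.rightRegular_basis hxr hi).norm.pow 2))

/-- Induction along the backstepping chain. It guarantees that the `derivWithin` in `lumped` is a
true right derivative and not the default value 0. -/
lemma rightRegular_virt : ∀ {i : ℕ}, i ≤ n → RightRegular T (virt P C xr S i)
  | 0, _ => by
    have := rightRegular_iteratedDeriv_ws (T := T) hxr 0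
    rwa [iteratedDeriv_zero] at this
  | i + 1, hi => by
    have ih := rightRegular_virt (i := i) (by omega)
    refine RightRegular.add (hS.rightRegular_feedback hxr (by omega) hi
      ((hS.rightRegular_w (by omega) hi).sub ih)) ?_
    have := rightRegular_iteratedDeriv_ws (T := T) hxr 1
    rw [iteratedDeriv_one] at this
    split_ifs
    · exact this
    · exact .const 0

lemma rightRegular_z {i : ℕ} (h1 : 1 ≤ i) (hi : i ≤ n) : RightRegular T (z P C xr S i) :=
  (hS.rightRegular_w h1 hi).sub (hS.rightRegular_virt hxr (by omega))

end IsSolution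

lemma Delta_pos {i : ℕ} (h1 : 1 ≤ i) (hi : i ≤ n) (v : ℝ) : 0 < Delta P i v := by
  have := P.ρ₁_pos i h1 hi
  have := P.ρ₂_pos i h1 hi
  unfold Delta
  positivity

namespace IsSolution

variable (hS : IsSolution P C xr S s T tk law) (hxr : AdmissibleReference P xr)

include hS hxr

lemma rightRegular_alphaN (hn : 1 ≤ n) : RightRegular T (alphaN P C xr S) := by
  refine RightRegular.mul ((hS.rightRegular_w hn le_rfl).comp (φ := fun v => 1 / Delta P n v)
    fun t _ _ => ?_) (hS.rightRegular_feedback hxr hn le_rfl (hS.rightRegular_z hxr hn le_rfl))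
  refine DifferentiableAt.div (differentiableAt_const _) ?_ (Delta_pos hn le_rfl _).ne'
  unfold Delta
  fun_prop

lemma rightRegular_dLaw (hn : 1 ≤ n) (l : Law) : RightRegular T (dLaw P C xr S l) := by
  have ha := hS.rightRegular_alphaN hxr hn
  have hz := hS.rightRegular_z hxr hn le_rfl
  have ht : ∀ {f : ℝ → ℝ}, RightRegular T f → RightRegular T fun t => Real.tanh (f t / C.Φ) :=
    fun {f} hf => hf.comp (φ := fun y => Real.tanh (y / C.Φ)) fun t _ _ =>
      (differentiable_tanh _).comp _ (differentiableAt_id.div_const _)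
  cases l
  · exact ha.sub ((RightRegular.const _).mul (ht (hz.mul (.const _))))
  · exact (RightRegular.const _).mul
      ((ha.mul (ht (hz.mul ha))).add ((RightRegular.const _).mul (ht (hz.mul (.const _)))))

end IsSolution

end Regularity

section Lyapunov

/-! ### Effect of the measurement error -/

/-- Solve for `G` according to its sign. Each case puts the wrong denominator under one term: `m ≥
0` repairs the case `G ≤ 0`, and `D ≤ 0` the case `G ≥ 0`. -/
lemma le_of_relative_error {θ m D G : ℝ} (h0 : 0 < θ) (h1 : θ < 1) (hm : 0 ≤ m) (hD : D ≤ 0)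
    (h : |D - G| ≤ θ * |G| + m) : G ≤ D / (1 + θ) + m / (1 - θ) := by
  have h1' : 0 < 1 - θ := by linarith
  have hle := neg_le_of_abs_le h
  rcases le_total G 0 with hG | hG
  · rw [abs_of_nonpos hG] at hle
    have : G ≤ (D + m) / (1 + θ) := by rw [le_div_iff₀ (by linarith)]; linarith
    rw [add_div] at this
    refine this.trans ?_
    gcongr
    linarith
  · rw [abs_of_nonneg hG] at hle
    have : G ≤ (D + m) / (1 - θ) := by rw [le_div_iff₀ h1']; linarith
    rw [add_div] at this
    refine this.trans ?_
    gcongr ?_ + _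
    rw [div_le_div_iff₀ h1' (by linarith)]
    nlinarith

/-- The error costs at most `|z| ϑbar`, which the `tanh` term pays back up to `0.2785 Φ`. -/
lemma fixed_law_le {Φ ϑ ϑbar z α g : ℝ} (hΦ : 0 < Φ) (h0 : 0 < ϑ) (h1 : ϑ < ϑbar)
    (h : |α - ϑbar * Real.tanh (z * ϑbar / Φ) - g| ≤ ϑ) : z * g ≤ z * α + 0.2785 * Φ := by
  have h2 := abs_sub_mul_tanh_div_le hΦ z ϑbar
  rw [abs_mul, abs_of_pos (h0.trans h1)] at h2
  have h3 : z * (g - (α - ϑbar * Real.tanh (z * ϑbar / Φ))) ≤ |z| * ϑbar := by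
    refine (le_abs_self _).trans ?_
    rw [abs_mul, abs_sub_comm]
    gcongr
    exact h.trans h1.le
  linarith

/-- The relative-threshold controller tolerates a scaled error `G` of the product `z * g`. -/
lemma relative_law_le {Φ θ b z α G : ℝ} (hΦ : 0 < Φ) (hθ : 0 < θ) (hb : 0 < b)
    (h : G ≤ z * (-(1 + θ) * (α * Real.tanh (z * α / Φ) + b * Real.tanh (z * b / Φ))) / (1 + θ)
      + |z| * b) : G ≤ z * α + 0.557 * Φ := by
  have h2 := abs_sub_mul_tanh_div_le hΦ z b
  have h3 := abs_sub_mul_tanh_div_le hΦ z α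
  rw [abs_mul z b, abs_of_pos hb] at h2
  have h4 : z * (-(1 + θ) * (α * Real.tanh (z * α / Φ) + b * Real.tanh (z * b / Φ))) / (1 + θ) =
      -(z * (α * Real.tanh (z * α / Φ))) - z * (b * Real.tanh (z * b / Φ)) := by
    field_simp
    ring
  -- The first `tanh` term yields about `-|z α|`, which is at most `z α`; two `tanh` losses make
  -- `0.557 Φ`.
  have h5 := neg_abs_le (z * α)
  linarith

/-- The law makes `z d ≤ 0`, so `le_of_relative_error` applies to the products with `z`. The gain `1
+ θ` cancels its denominator, and `b` dominates `ϑ₁ / (1 - θ)`. -/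
lemma relative_threshold_le {Φ θ ϑ₁ b z α g : ℝ} (hΦ : 0 < Φ) (h0 : 0 < θ) (h1 : θ < 1)
    (hϑ : 0 < ϑ₁) (hb : ϑ₁ / (1 - θ) < b)
    (h : |-(1 + θ) * (α * Real.tanh (z * α / Φ) + b * Real.tanh (z * b / Φ)) - g| ≤
      θ * |g| + ϑ₁) : z * g ≤ z * α + 0.557 * Φ := by
  have h1' : 0 < 1 - θ := by linarith
  have hb0 : 0 < b := lt_trans (by positivity) hb
  set d := -(1 + θ) * (α * Real.tanh (z * α / Φ) + b * Real.tanh (z * b / Φ)) with hd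
  have hzd : z * d ≤ 0 := by
    have e1 := mul_mul_tanh_div_nonneg hΦ z α
    have e2 := mul_mul_tanh_div_nonneg hΦ z b
    have : z * d = -((1 + θ) * (z * (α * Real.tanh (z * α / Φ))
      + z * (b * Real.tanh (z * b / Φ)))) := by rw [hd]; ring
    rw [this, neg_nonpos]
    positivity
  have key := le_of_relative_error (D := z * d) (G := z * g) (m := |z| * ϑ₁) h0 h1 (by positivity)
    hzd (by
      rw [← mul_sub, abs_mul, abs_mul]
      refine (mul_le_mul_of_nonneg_left h (abs_nonneg z)).trans (le_of_eq (by ring)))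
  refine relative_law_le hΦ h0 hb0 (key.trans ?_)
  rw [mul_div_assoc |z|]
  gcongr

/-- Since `z d ≤ 0`, dividing by `1 + θ` only increases it, so the surplus gain of the relative law
is harmless under an absolute threshold. -/
lemma relative_law_fixed_threshold_le {Φ θ ϑ b z α g : ℝ} (hΦ : 0 < Φ) (h0 : 0 < θ) (hϑ : 0 < ϑ)
    (hb : ϑ < b) (h : |-(1 + θ) * (α * Real.tanh (z * α / Φ) + b * Real.tanh (z * b / Φ)) - g| ≤
      ϑ) : z * g ≤ z * α + 0.557 * Φ := by
  have hb0 : 0 < b := hϑ.trans hb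
  set d := -(1 + θ) * (α * Real.tanh (z * α / Φ) + b * Real.tanh (z * b / Φ)) with hd
  have hzd : z * d ≤ z * d / (1 + θ) := by
    have e1 := mul_mul_tanh_div_nonneg hΦ z α
    have e2 := mul_mul_tanh_div_nonneg hΦ z b
    have : z * d = -((1 + θ) * (z * (α * Real.tanh (z * α / Φ))
      + z * (b * Real.tanh (z * b / Φ)))) := by rw [hd]; ring
    have e3 : z * d ≤ 0 := by
      rw [this, neg_nonpos]
      positivity
    rw [le_div_iff₀ (by linarith)]
    nlinarith
  refine relative_law_le hΦ h0 hb0 ?_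
  have h3 : z * (g - d) ≤ |z| * b := by
    refine (le_abs_self _).trans ?_
    rw [abs_mul, abs_sub_comm]
    gcongr
    exact h.trans hb.le
  linarith

variable {n : ℕ} {P : Plant n} {C : Controller n} {xr : ℝ → ℝ} {S : Signals} {s : Scheme}
  {T : EReal} {tk : ℕ → EReal} {law : ℕ → Law}

/-! ### Triggering times and sampled inputs -/

lemma threshold_nonneg (hC : C.Admissible s) (v : ℝ) : 0 ≤ threshold C s v := by
  have := abs_nonneg v
  cases s
  · exact hC.1.le
  · exact add_nonneg (mul_nonneg hC.1.le this) hC.2.2.1.le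
  · simp only [threshold]
    split_ifs
    · exact add_nonneg (mul_nonneg hC.2.1.le this) hC.2.2.2.1.le
    · exact hC.1.1.le
  · exact add_nonneg (mul_nonneg hC.1.1.le this) hC.1.2.2.1.le

lemma NextTrigger.le {D : ℝ → ℝ} {s₀ : ℝ} {next : EReal}
    (h : NextTrigger C T s D s₀ next) : (s₀ : EReal) ≤ next := by
  have ev : (s₀ : EReal) ≤ sInf {r : EReal | ∃ t : ℝ, s₀ < t ∧ (t : EReal) < T ∧
      threshold C s (D s₀) ≤ |D t - D s₀| ∧ r = (t : EReal)} := by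
    refine le_sInf ?_
    rintro r ⟨t, ht, -, -, rfl⟩
    exact EReal.coe_le_coe_iff.2 ht.le
  cases s
  · exact ev.trans_eq (Eq.symm h)
  · exact ev.trans_eq (Eq.symm h)
  · exact ev.trans_eq (Eq.symm h)
  · obtain ⟨m, hm, -⟩ := h
    by_contra! hlt
    -- The empty set has no least upper bound in `ℝ`, so the existence of `m` already puts a time
    -- into the inter-event interval.
    obtain ⟨r, t, h1, h2, -⟩ := hm.nonempty
    exact absurd (EReal.coe_le_coe_iff.2 h1) (not_le.2 (h2.trans hlt))

/-- Between triggering times the measurement error stays below the threshold. -/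
lemma NextTrigger.abs_sub_le {D : ℝ → ℝ} {s₀ t : ℝ} {next : EReal} (hC : C.Admissible s)
    (hD : RightRegular T D) (h : NextTrigger C T s D s₀ next) (h0 : 0 ≤ s₀) (hst : s₀ ≤ t)
    (ht : (t : EReal) < next) (htT : (t : EReal) < T) :
    |D t - D s₀| ≤ threshold C s (D s₀) := by
  have ev : next = sInf {r : EReal | ∃ t : ℝ, s₀ < t ∧ (t : EReal) < T ∧
      threshold C s (D s₀) ≤ |D t - D s₀| ∧ r = (t : EReal)} →
      |D t - D s₀| ≤ threshold C s (D s₀) := by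
    intro hn
    rcases hst.eq_or_lt with rfl | hlt
    · simpa using threshold_nonneg hC _
    · by_contra! hc
      have : next ≤ t := hn ▸ sInf_le ⟨t, hlt, htT, hc.le, rfl⟩
      exact absurd ht (not_lt.2 this)
  cases s
  · exact ev h
  · exact ev h
  · exact ev h
  · obtain ⟨m, hm, hn⟩ := h
    have below : ∀ r ∈ Icc s₀ t, (r : EReal) ≤ t := fun r hr => EReal.coe_le_coe_iff.2 hr.2
    have bound : ∀ r ∈ Icc s₀ t, max |derivWithin D (Ici r) r| C.rate ≤ m := fun r hr =>
      hm.1 ⟨r, hr.1, (below r hr).trans_lt ht, (below r hr).trans_lt htT, rfl⟩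
    have hm0 : 0 < m := hC.2.trans_le ((le_max_right _ _).trans (bound s₀ ⟨le_rfl, hst⟩))
    -- The error grows at rate at most `m`, and the interval has length threshold divided by `m`.
    have mv := norm_image_sub_le_of_norm_deriv_right_le_segment
      (f' := fun r => derivWithin D (Ici r) r) (C := m) (hD.continuousOn_Icc h0 htT)
      (fun r hr => (hD.2 r (h0.trans hr.1)
        ((below r ⟨hr.1, hr.2.le⟩).trans_lt htT)).hasDerivWithinAt)
      (fun r hr => (le_max_left _ _).trans (bound r ⟨hr.1, hr.2.le⟩)) t ⟨hst, le_rfl⟩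
    rw [hn, EReal.coe_lt_coe_iff] at ht
    refine mv.trans ?_
    have : t - s₀ ≤ threshold C .selfTriggered (D s₀) / m := by linarith
    rw [le_div_iff₀ hm0] at this
    linarith

namespace IsSolution

variable (hS : IsSolution P C xr S s T tk law)
include hS

lemma tk_nonneg (j : ℕ) : 0 ≤ tk j := by
  induction j with
  | zero => exact hS.tk_zero.ge
  | succ j ih =>
    rcases lt_or_ge (tk j) T with h | h
    · have hreal : ((tk j).toReal : EReal) = tk j :=
        EReal.coe_toReal (h.trans_le le_top).ne (ne_of_gt (EReal.bot_lt_zero.trans_le ih))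
      have := (hS.tk_next j h).le
      rw [hreal] at this
      exact ih.trans this
    · rw [hS.tk_top j h]; exact le_top

/-- At every time the applied input is a sample of the running controller, and the measurement error
respects the threshold. -/
lemma exists_sample (hxr : AdmissibleReference P xr) (hC : C.Admissible s) (hn : 1 ≤ n) {t : ℝ}
    (h0 : 0 ≤ t) (hT : (t : EReal) < T) : ∃ (l : Law) (s₀ : ℝ), 0 ≤ s₀ ∧ (s₀ : EReal) < T ∧
      S.d t = dLaw P C xr S l t ∧ S.g t = dLaw P C xr S l s₀ ∧
      LawAllowed C s (S.g t) l ∧ |S.d t - S.g t| ≤ threshold C s (S.g t) := by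
  obtain ⟨j, hj, hj'⟩ := hS.tk_cover t h0 hT
  have hjT : tk j < T := hj.trans_lt hT
  have hnn := hS.tk_nonneg j
  have hreal : ((tk j).toReal : EReal) = tk j :=
    EReal.coe_toReal (hjT.trans_le le_top).ne (ne_of_gt (EReal.bot_lt_zero.trans_le hnn))
  set s₀ := (tk j).toReal with hs₀
  have hs0 : 0 ≤ s₀ := by rw [← hreal] at hnn; exact_mod_cast hnn
  have hst : s₀ ≤ t := by rw [← hreal] at hj; exact_mod_cast hj
  have hd := hS.d_eq j t hj hj' hT
  have hg : S.g t = dLaw P C xr S (law j) s₀ := by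
    rw [hS.g_eq j t hj hj' hT, ← hs₀]
    exact hS.d_eq j s₀ hreal.ge (hreal ▸ hj.trans_lt hj') (hreal ▸ hjT)
  refine ⟨law j, s₀, hs0, hreal ▸ hjT, hd, hg, ?_, ?_⟩
  · rw [hg]; exact hS.law_allowed j hjT
  · rw [hd, hg]
    exact (hS.tk_next j hjT).abs_sub_le hC (hS.rightRegular_dLaw hxr hn _) hs0 hst hj' hT

/-- The only way the scheme enters the stability analysis. In the switched scheme the constant
majorizes those of all its modes; the factor `Δ n ≤ R` is restored later. -/
lemma z_mul_g_le (hxr : AdmissibleReference P xr) (hC : C.Admissible s) (hn : 1 ≤ n) {t : ℝ}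
    (h0 : 0 ≤ t) (hT : (t : EReal) < T) :
    z P C xr S n t * S.g t ≤ z P C xr S n t * alphaN P C xr S t + triggerConst C s 1 := by
  obtain ⟨l, s₀, -, -, hd, -, hl, he⟩ := hS.exists_sample hxr hC hn h0 hT
  have hΦ := C.Φ_pos
  rw [hd] at he
  cases s
  · obtain rfl : l = .fixed := hl
    refine (fixed_law_le hΦ hC.1 hC.2 he).trans (le_of_eq ?_)
    simp [triggerConst]
  · obtain rfl : l = .relative := hl
    refine (relative_threshold_le hΦ hC.1 hC.2.1 hC.2.2.1 hC.2.2.2 he).trans (le_of_eq ?_)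
    simp [triggerConst]
  · obtain ⟨⟨c1, c2⟩, c3, c4, c5, c6⟩ := hC
    obtain ⟨l1, l2⟩ := hl
    simp only [threshold] at he
    simp only [triggerConst]
    split_ifs at he with hlt
    · obtain rfl := l1 hlt
      linarith [relative_threshold_le hΦ c3 c4 c5 c6 he]
    · rcases l2 (not_lt.1 hlt) with rfl | ⟨rfl, hϑ⟩
      · linarith [fixed_law_le hΦ c1 c2 he]
      · linarith [relative_law_fixed_threshold_le hΦ c3 c1 hϑ he]
  · obtain rfl : l = .relative := hl
    obtain ⟨⟨c3, c4, c5, c6⟩, -⟩ := hC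
    refine (relative_threshold_le hΦ c3 c4 c5 c6 he).trans (le_of_eq ?_)
    simp [triggerConst]

end IsSolution

lemma triggerConst_nonneg {R : ℝ} (hR : 0 ≤ R) : 0 ≤ triggerConst C s R := by
  have := C.Φ_pos
  cases s <;> simp only [triggerConst] <;> positivity

lemma triggerConst_mul_one {R r : ℝ} (h : r ≤ R) :
    r * triggerConst C s 1 ≤ triggerConst C s R := by
  have h' := mul_le_mul_of_nonneg_right h C.Φ_pos.le
  cases s <;> simp only [triggerConst] <;> linarith

/-! ### Error dynamics -/

/-- The stabilizing part of the virtual control laws. -/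
noncomputable def feedback (P : Plant n) (C : Controller n) (xr : ℝ → ℝ) (S : Signals) (i : ℕ)
    (t : ℝ) : ℝ :=
  -C.k₁ i * sig (2 * C.q - 1) (z P C xr S i t)
    - 1 / (2 * C.u i ^ 2) * z P C xr S i t * S.φhat i t * ‖basis C i (Z P xr S i t)‖ ^ 2

lemma virt_eq {i : ℕ} (hi : 1 ≤ i) (t : ℝ) : virt P C xr S i t =
    feedback P C xr S i t + if i = 1 then deriv (ws P xr) t else 0 := by
  obtain ⟨i, rfl⟩ := Nat.exists_eq_add_of_le' hi
  simp only [virt, feedback, z, Nat.add_sub_cancel, Nat.add_eq_right]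

lemma Delta_mul_alphaN (hn : 1 ≤ n) (t : ℝ) :
    Delta P n (w P S n t) * alphaN P C xr S t = feedback P C xr S n t := by
  have := (Delta_pos (P := P) hn le_rfl (w P S n t)).ne'
  unfold alphaN feedback
  field_simp

/-- The right derivative of the `i`-th error. -/
lemma IsSolution.hasDerivWithinAt_z (hS : IsSolution P C xr S s T tk law)
    (hxr : AdmissibleReference P xr) (hn : 2 ≤ n) {i : ℕ} (h1 : 1 ≤ i) (hi : i ≤ n) {t : ℝ}
    (h0 : 0 ≤ t) (hT : (t : EReal) < T) :
    HasDerivWithinAt (z P C xr S i)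
      (lumped P C xr S i t - z P C xr S i t / 2 - C.k₂ i * sig (2 * C.p - 1) (z P C xr S i t)
        - (if i = 1 then 0 else z P C xr S (i - 1) t)
        + (if i < n then z P C xr S (i + 1) t
            else Delta P n (w P S n t) * (S.g t - alphaN P C xr S t))
        + feedback P C xr S i t) (Ici t) t := by
  -- For `i = 1` this derivative is cancelled by the feedforward term in `virt 1`; for `i ≥ 2` it is
  -- part of `lumped`.
  have hv : HasDerivWithinAt (virt P C xr S (i - 1))
      (if i = 1 then deriv (ws P xr) t else derivWithin (virt P C xr S (i - 1)) (Ici t) t)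
      (Ici t) t := by
    split_ifs with h
    · subst h
      exact (hasDerivAt_ws hxr h0).differentiableAt.hasDerivAt.hasDerivWithinAt
    · exact ((hS.rightRegular_virt hxr (by omega)).2 t h0 hT).hasDerivWithinAt
  rcases hi.lt_or_eq with hlt | rfl
  · refine ((hS.hasDerivWithinAt_w h1 hi h0 hT (hS.x_eq i h1 hlt t h0 hT)).sub hv).congr_deriv ?_
    have hz : z P C xr S (i + 1) t = w P S (i + 1) t - virt P C xr S i t := rfl
    rw [hz, virt_eq h1]
    simp only [lumped, aux, if_pos hlt]
    split_ifs <;> ring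
  · refine ((hS.hasDerivWithinAt_w h1 hi h0 hT (hS.xn_eq t h0 hT)).sub hv).congr_deriv ?_
    rw [mul_sub, Delta_mul_alphaN h1]
    have : i ≠ 1 := by omega
    simp only [lumped, aux, if_neg (lt_irrefl i), if_neg this]
    ring

/-! ### The Lyapunov estimate -/

lemma one_lt_ε {i : ℕ} (h1 : 1 ≤ i) (hi : i ≤ n) : 1 < C.ε i := by
  have := C.f_gt i h1 hi
  unfold Controller.ε
  rw [one_lt_div (by linarith)]
  linarith

/-- Here `1/ε = 1 - 1/(2f)`, and the claim is `2f² - 2f + 1 ≥ 0`. -/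
lemma one_div_ε_le {i : ℕ} (h1 : 1 ≤ i) (hi : i ≤ n) : 1 / C.ε i ≤ C.f i := by
  have := C.f_gt i h1 hi
  unfold Controller.ε
  rw [one_div_div, div_le_iff₀ (by linarith)]
  nlinarith [sq_nonneg (C.f i - 1)]

/-- Young's inequality twice. The first term is left for the adaptation to cancel, and `z²/2` is
compensated by the `z/2` built into `lumped`. -/
lemma mul_lumped_le {z U v η σ lam u : ℝ} (hu : 0 < u)
    (hv : |v| ≤ η * σ) (hU : |U - v| ≤ lam) :
    z * U ≤ z ^ 2 * η ^ 2 * σ ^ 2 / (2 * u ^ 2) + u ^ 2 / 2 + z ^ 2 / 2 + lam ^ 2 / 2 := by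
  have h1 : z * v ≤ |z| * (η * σ) := (le_abs_self _).trans (by rw [abs_mul]; gcongr)
  have h2 : z * (U - v) ≤ |z| * lam := (le_abs_self _).trans (by rw [abs_mul]; gcongr)
  have h3 : |z| * (η * σ) ≤ z ^ 2 * η ^ 2 * σ ^ 2 / (2 * u ^ 2) + u ^ 2 / 2 := by
    have e : z ^ 2 * η ^ 2 * σ ^ 2 / (2 * u ^ 2) + u ^ 2 / 2 - |z| * (η * σ) =
        (|z| * η * σ / u - u) ^ 2 / 2 := by
      rw [← sq_abs z]
      field_simp
      ring
    have : 0 ≤ (|z| * η * σ / u - u) ^ 2 / 2 := by positivity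
    linarith
  have h4 : |z| * lam ≤ z ^ 2 / 2 + lam ^ 2 / 2 := by
    rw [← sq_abs z]
    nlinarith [sq_nonneg (|z| - lam)]
  linarith

/-- From `(φ - φhat) φhat = (φ² - (φ - φhat)² - φhat²) / 2`, dropping the last square: leakage turns
into decay of the estimation error. -/
lemma adaptation_le {τ ε f φ φhat : ℝ} (hτ : 0 ≤ τ) (hε : 0 < ε) (hf : 1 / ε ≤ f) :
    τ * ((φ - φhat) * φhat) / ε ≤ -(τ * ((φ - φhat) ^ 2 / (2 * ε))) + f * τ / 2 * φ ^ 2 := by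
  have h : τ * ((φ - φhat) * φhat) / ε =
      -(τ * ((φ - φhat) ^ 2 / (2 * ε))) + 1 / ε * (τ / 2 * φ ^ 2)
        - τ / (2 * ε) * φhat ^ 2 := by
    field_simp
    ring
  have h1 : 0 ≤ τ / (2 * ε) * φhat ^ 2 := by positivity
  have h2 := mul_le_mul_of_nonneg_right hf (show 0 ≤ τ / 2 * φ ^ 2 by positivity)
  rw [h]
  linarith

lemma gainMin_le {i : ℕ} (h1 : 1 ≤ i) (hi : i ≤ n) : gainMin C ≤ 2 ^ C.q * C.k₁ i ∧
    gainMin C ≤ 2 ^ C.p * C.k₂ i ∧ gainMin C ≤ C.τ i := by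
  obtain ⟨i, rfl⟩ := Nat.exists_eq_add_of_le' h1
  have h : gainMin C ≤ _ := ciInf_le (finite_range _).bddBelow (⟨i, by omega⟩ : Fin n)
  exact ⟨h.trans ((min_le_left _ _).trans (min_le_left _ _)),
    h.trans ((min_le_left _ _).trans (min_le_right _ _)), h.trans (min_le_right _ _)⟩

lemma gainMin_pos (hn : 1 ≤ n) : 0 < gainMin C := by
  have : Nonempty (Fin n) := ⟨⟨0, hn⟩⟩
  obtain ⟨o, ho⟩ := exists_eq_ciInf_of_finite (f := fun o : Fin n =>
    min (min (2 ^ C.q * C.k₁ (o + 1)) (2 ^ C.p * C.k₂ (o + 1))) (C.τ (o + 1)))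
  rw [gainMin, ← ho]
  have ho := o.2
  have := C.k₁_pos (o + 1) (by omega) (by omega)
  have := C.k₂_pos (o + 1) (by omega) (by omega)
  have := C.τ_pos (o + 1) (by omega) (by omega)
  positivity

/-- The part of the residual constant that does not depend on the bounds for the estimation
errors. -/
noncomputable def baseConst (C : Controller n) (H : (i : ℕ) → EuclideanSpace ℝ (Fin (C.N i)))
    (lam : ℕ → ℝ) (s : Scheme) (R : ℝ) : ℝ :=
  ∑ i ∈ Finset.Icc 1 n,
    (C.u i ^ 2 / 2 + lam i ^ 2 / 2 + C.f i * C.τ i / 2 * (‖H i‖ ^ 2) ^ 2) + triggerConst C s R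

lemma sum_Icc_sub_pred (c : ℕ → ℝ) (m : ℕ) :
    ∑ i ∈ Finset.Icc 1 m, (c i - c (i - 1)) = c m - c 0 := by
  induction m with
  | zero => simp
  | succ m ih =>
    rw [Finset.sum_Icc_succ_top (by omega), ih, Nat.add_sub_cancel]
    ring

variable {H : (i : ℕ) → EuclideanSpace ℝ (Fin (C.N i))} {lam : ℕ → ℝ} {R : ℝ}

lemma IsSolution.rightRegular_φtilde (hS : IsSolution P C xr S s T tk law) {i : ℕ} (h1 : 1 ≤ i)
    (hi : i ≤ n) : RightRegular T (φtilde C S H i) :=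
  (RightRegular.const (‖H i‖ ^ 2)).sub (hS.rightRegular_φhat h1 hi)

lemma IsSolution.rightRegular_V (hS : IsSolution P C xr S s T tk law)
    (hxr : AdmissibleReference P xr) : RightRegular T (V P C xr S H) := by
  refine RightRegular.sum fun i hi => ?_
  obtain ⟨h1, hi⟩ := Finset.mem_Icc.1 hi
  have := one_lt_ε (C := C) h1 hi
  refine RightRegular.congr (((hS.rightRegular_z hxr h1 hi).pow 2).mul (.const (1 / 2)) |>.add
    (((hS.rightRegular_φtilde (H := H) h1 hi).pow 2).mul (.const (1 / (2 * C.ε i))))) fun t => ?_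
  ring

/-- Contribution of one subsystem to the derivative of the Lyapunov function. -/
lemma summand_deriv_le {i : ℕ} (h1 : 1 ≤ i) (hi : i ≤ n) {ζ U v σ φhat nxt prev μ : ℝ}
    (hv : |v| ≤ ‖H i‖ * σ) (hU : |U - v| ≤ μ) :
    ζ * (U - ζ / 2 - C.k₂ i * sig (2 * C.p - 1) ζ - prev + nxt
        + (-C.k₁ i * sig (2 * C.q - 1) ζ - 1 / (2 * C.u i ^ 2) * ζ * φhat * σ ^ 2))
      + (‖H i‖ ^ 2 - φhat) * -(C.ε i / (2 * C.u i ^ 2) * ζ ^ 2 * σ ^ 2 - C.τ i * φhat) / C.ε i ≤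
    -(gainMin C * (ζ ^ 2 / 2) ^ C.q) - gainMin C * (ζ ^ 2 / 2) ^ C.p
      - gainMin C * ((‖H i‖ ^ 2 - φhat) ^ 2 / (2 * C.ε i))
      + (C.u i ^ 2 / 2 + μ ^ 2 / 2 + C.f i * C.τ i / 2 * (‖H i‖ ^ 2) ^ 2)
      + (ζ * nxt - ζ * prev) := by
  obtain ⟨g1, g2, g3⟩ := gainMin_le (C := C) h1 hi
  have hε : 0 < C.ε i := zero_lt_one.trans (one_lt_ε h1 hi)
  have hu := C.u_pos i h1 hi
  have hq := C.q_gt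
  have e1 := mul_sig_two_mul_sub_one (s := C.q) (by linarith) ζ
  have e2 := mul_sig_two_mul_sub_one C.p_pos ζ
  have b1 := mul_le_mul_of_nonneg_right g1 (show 0 ≤ (ζ ^ 2 / 2) ^ C.q by positivity)
  have b2 := mul_le_mul_of_nonneg_right g2 (show 0 ≤ (ζ ^ 2 / 2) ^ C.p by positivity)
  have b3 := mul_le_mul_of_nonneg_right g3
    (show 0 ≤ (‖H i‖ ^ 2 - φhat) ^ 2 / (2 * C.ε i) by positivity)
  have b4 := mul_lumped_le (z := ζ) hu hv hU
  have b5 := adaptation_le (φ := ‖H i‖ ^ 2) (φhat := φhat) (C.τ_pos i h1 hi).le hε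
    (one_div_ε_le h1 hi)
  have e3 : (‖H i‖ ^ 2 - φhat) * -(C.ε i / (2 * C.u i ^ 2) * ζ ^ 2 * σ ^ 2 - C.τ i * φhat) / C.ε i
      = -(‖H i‖ ^ 2 - φhat) * (ζ ^ 2 * σ ^ 2 / (2 * C.u i ^ 2))
        + C.τ i * ((‖H i‖ ^ 2 - φhat) * φhat) / C.ε i := by
    field_simp
    ring
  have e4 : ζ * (U - ζ / 2 - C.k₂ i * sig (2 * C.p - 1) ζ - prev + nxt
        + (-C.k₁ i * sig (2 * C.q - 1) ζ - 1 / (2 * C.u i ^ 2) * ζ * φhat * σ ^ 2)) =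
      ζ * U - ζ ^ 2 / 2 - 2 ^ C.p * C.k₂ i * (ζ ^ 2 / 2) ^ C.p
        - 2 ^ C.q * C.k₁ i * (ζ ^ 2 / 2) ^ C.q - φhat * (ζ ^ 2 * σ ^ 2 / (2 * C.u i ^ 2))
        + (ζ * nxt - ζ * prev) := by
    linear_combination (-C.k₂ i) * e2 - C.k₁ i * e1
  rw [e3, e4]
  -- The multiples of `ζ² σ² / (2u²)` have coefficients `‖H‖²` from Young, `-φhat` from the feedback
  -- and `-(‖H‖² - φhat)` from the adaptive law; they sum to zero.
  have e5 : ζ ^ 2 * ‖H i‖ ^ 2 * σ ^ 2 / (2 * C.u i ^ 2) =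
    ‖H i‖ ^ 2 * (ζ ^ 2 * σ ^ 2 / (2 * C.u i ^ 2)) := by ring
  linarith

lemma IsSolution.derivWithin_V_le (hS : IsSolution P C xr S s T tk law)
    (hxr : AdmissibleReference P xr) (hC : C.Admissible s) (hn : 2 ≤ n)
    (hA : Approximates P C xr S H lam T) {t : ℝ} (h0 : 0 ≤ t) (hT : (t : EReal) < T)
    (hR : Delta P n (w P S n t) ≤ R) :
    derivWithin (V P C xr S H) (Ici t) t ≤
      -(gainMin C * ∑ i ∈ Finset.Icc 1 n, (z P C xr S i t ^ 2 / 2) ^ C.q)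
        - gainMin C * ∑ i ∈ Finset.Icc 1 n, (z P C xr S i t ^ 2 / 2) ^ C.p
        - gainMin C * ∑ i ∈ Finset.Icc 1 n, φtilde C S H i t ^ 2 / (2 * C.ε i)
        + baseConst C H lam s R := by
  set nxt : ℕ → ℝ := fun i => if i < n then z P C xr S (i + 1) t
    else Delta P n (w P S n t) * (S.g t - alphaN P C xr S t) with hnxt
  set prev : ℕ → ℝ := fun i => if i = 1 then 0 else z P C xr S (i - 1) t with hprev
  have hderiv : HasDerivWithinAt (V P C xr S H) (∑ i ∈ Finset.Icc 1 n, (z P C xr S i t *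
      (lumped P C xr S i t - z P C xr S i t / 2 - C.k₂ i * sig (2 * C.p - 1) (z P C xr S i t)
        - prev i + nxt i + feedback P C xr S i t) + φtilde C S H i t *
      -(C.ε i / (2 * C.u i ^ 2) * z P C xr S i t ^ 2 * ‖basis C i (Z P xr S i t)‖ ^ 2
        - C.τ i * S.φhat i t) / C.ε i)) (Ici t) t := by
    refine HasDerivWithinAt.fun_sum fun i hi => ?_
    obtain ⟨h1, hi⟩ := Finset.mem_Icc.1 hi
    have hε : 0 < C.ε i := zero_lt_one.trans (one_lt_ε h1 hi)
    refine (((hS.hasDerivWithinAt_z hxr hn h1 hi h0 hT).pow 2).div_const 2 |>.add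
      (((hS.φ_eq i h1 hi t h0 hT).const_sub (‖H i‖ ^ 2)).pow 2 |>.div_const
        (2 * C.ε i))).congr_deriv ?_
    simp only [hnxt, hprev, φtilde]
    field_simp
    ring
  rw [hderiv.derivWithin (uniqueDiffWithinAt_Ici t)]
  -- The couplings between neighbours, cut off so that both ends of the telescoping sum vanish; only
  -- the triggering error in subsystem `n` remains.
  set c : ℕ → ℝ := fun i => if 1 ≤ i ∧ i < n then z P C xr S i t * z P C xr S (i + 1) t else 0
    with hc
  have hΛ : z P C xr S n t * (Delta P n (w P S n t) * (S.g t - alphaN P C xr S t)) ≤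
      triggerConst C s R := by
    have h := hS.z_mul_g_le hxr hC (by omega) h0 hT
    have hΔ := Delta_pos (P := P) (by omega) le_rfl (w P S n t)
    refine le_trans (le_of_eq_of_le (by ring) (mul_le_mul_of_nonneg_left
      (show z P C xr S n t * S.g t - z P C xr S n t * alphaN P C xr S t ≤ triggerConst C s 1 by
        linarith) hΔ.le)) (triggerConst_mul_one hR)
  have hsum : ∑ i ∈ Finset.Icc 1 n, (z P C xr S i t * nxt i - z P C xr S i t * prev i) ≤
      triggerConst C s R := by
    have hstep : ∀ i ∈ Finset.Icc 1 n, z P C xr S i t * nxt i - z P C xr S i t * prev i =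
        (c i - c (i - 1)) + if i = n then
          z P C xr S n t * (Delta P n (w P S n t) * (S.g t - alphaN P C xr S t)) else 0 := by
      intro i hi
      obtain ⟨h1, hi⟩ := Finset.mem_Icc.1 hi
      have hp : z P C xr S i t * prev i = c (i - 1) := by
        simp only [hprev, hc]
        by_cases h : i = 1
        · simp [h]
        · rw [if_neg h, if_pos (by omega), Nat.sub_add_cancel h1, mul_comm]
      rw [hp]
      rcases hi.lt_or_eq with h | rfl
      · simp only [hnxt, hc, if_pos h, if_pos (And.intro h1 h), if_neg h.ne]
        ring
      · simp only [hnxt, hc, if_neg (lt_irrefl i), lt_irrefl, and_false, if_true, if_false]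
        ring
    rw [Finset.sum_congr rfl hstep, Finset.sum_add_distrib, sum_Icc_sub_pred,
      Finset.sum_ite_eq' (Finset.Icc 1 n) n, if_pos (Finset.mem_Icc.2 ⟨by omega, le_rfl⟩)]
    simpa [hc] using hΛ
  have hmain := Finset.sum_le_sum fun i (hi : i ∈ Finset.Icc 1 n) => by
    obtain ⟨h1, hi⟩ := Finset.mem_Icc.1 hi
    exact summand_deriv_le (C := C) (H := H) h1 hi (ζ := z P C xr S i t)
      (U := lumped P C xr S i t) (φhat := S.φhat i t) (nxt := nxt i) (prev := prev i)
      (abs_real_inner_le_norm (H i) (basis C i (Z P xr S i t))) (hA i h1 hi t h0 hT)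
  refine hmain.trans ?_
  simp only [Finset.sum_add_distrib,
    Finset.sum_sub_distrib, Finset.sum_neg_distrib, ← Finset.mul_sum] at hsum ⊢
  simp only [baseConst, φtilde, Finset.sum_add_distrib]
  linarith

end Lyapunov

/-! ### Consequences of the Lyapunov estimate: boundedness and fixed-time decay -/

section Boundedness

variable {n : ℕ} {P : Plant n} {C : Controller n} {xr : ℝ → ℝ} {S : Signals} {s : Scheme}
  {T : EReal} {tk : ℕ → EReal} {law : ℕ → Law}
  {H : (i : ℕ) → EuclideanSpace ℝ (Fin (C.N i))} {lam : ℕ → ℝ} {R : ℝ}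

lemma V_eq (t : ℝ) : V P C xr S H t = ∑ i ∈ Finset.Icc 1 n, z P C xr S i t ^ 2 / 2 +
    ∑ i ∈ Finset.Icc 1 n, φtilde C S H i t ^ 2 / (2 * C.ε i) :=
  Finset.sum_add_distrib

lemma sum_φtilde_sq_nonneg (t : ℝ) :
    0 ≤ ∑ i ∈ Finset.Icc 1 n, φtilde C S H i t ^ 2 / (2 * C.ε i) := by
  refine Finset.sum_nonneg fun i hi => ?_
  obtain ⟨h1, hi⟩ := Finset.mem_Icc.1 hi
  have := one_lt_ε (C := C) h1 hi
  positivity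

lemma summand_le_V {i : ℕ} (h1 : 1 ≤ i) (hi : i ≤ n) (t : ℝ) :
    z P C xr S i t ^ 2 / 2 + φtilde C S H i t ^ 2 / (2 * C.ε i) ≤ V P C xr S H t := by
  refine Finset.single_le_sum (f := fun i => z P C xr S i t ^ 2 / 2 +
    φtilde C S H i t ^ 2 / (2 * C.ε i)) (fun j hj => ?_) (Finset.mem_Icc.2 ⟨h1, hi⟩)
  obtain ⟨h1, hi⟩ := Finset.mem_Icc.1 hj
  have := one_lt_ε (C := C) h1 hi
  positivity

/-- The Lyapunov function stays below its initial bound and the residual level. -/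
lemma IsSolution.V_le (hS : IsSolution P C xr S s T tk law)
    (hxr : AdmissibleReference P xr) (hC : C.Admissible s) (hn : 2 ≤ n)
    (hA : Approximates P C xr S H lam T)
    (hR : ∀ t : ℝ, 0 ≤ t → (t : EReal) < T → Delta P n (w P S n t) ≤ R) {M : ℝ}
    (hM : V P C xr S H 0 ≤ M) {t : ℝ} (h0 : 0 ≤ t) (hT : (t : EReal) < T) :
    V P C xr S H t ≤ max M (baseConst C H lam s R / gainMin C) := by
  have hreg := hS.rightRegular_V (H := H) hxr
  have hκ := gainMin_pos (C := C) (by omega : 1 ≤ n)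
  have lt : ∀ x ∈ Ico 0 t, (x : EReal) < T := fun x hx =>
    (EReal.coe_lt_coe_iff.2 hx.2).trans hT
  refine le_of_right_deriv_neg_above h0 (hreg.continuousOn_Icc le_rfl hT)
    (fun x hx => (hreg.2 x hx.1 (lt x hx)).hasDerivWithinAt) (fun x hx hK => ?_)
    (hM.trans (le_max_left _ _))
  have h1 := hS.derivWithin_V_le hxr hC hn hA hx.1 (lt x hx) (hR x hx.1 (lt x hx))
  have h2 := (le_max_right M (baseConst C H lam s R / gainMin C)).trans_lt hK
  rw [div_lt_iff₀ hκ, V_eq] at h2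
  -- The two powers together dominate the linear term, so the decay is at least `gainMin * V`,
  -- without any prior bound on the estimation errors.
  have h3 : ∑ i ∈ Finset.Icc 1 n, z P C xr S i x ^ 2 / 2 ≤
      ∑ i ∈ Finset.Icc 1 n, (z P C xr S i x ^ 2 / 2) ^ C.q +
      ∑ i ∈ Finset.Icc 1 n, (z P C xr S i x ^ 2 / 2) ^ C.p := by
    rw [← Finset.sum_add_distrib]
    exact Finset.sum_le_sum fun i _ => le_rpow_add_rpow C.p_pos C.p_lt C.q_gt (by positivity)
  have h4 := mul_le_mul_of_nonneg_left h3 hκ.le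
  linarith

/-- The estimation errors decay only linearly. Their `q`-th power is charged to `c` through `γ`;
their `p`-th power is dominated by the linear decay plus the AM-GM constant. -/
lemma IsSolution.derivWithin_V_le_fixed_time (hS : IsSolution P C xr S s T tk law)
    (hxr : AdmissibleReference P xr) (hC : C.Admissible s) (hn : 2 ≤ n)
    (hA : Approximates P C xr S H lam T) {t : ℝ} (h0 : 0 ≤ t) (hT : (t : EReal) < T)
    (hR : Delta P n (w P S n t) ≤ R) {γ : ℕ → ℝ}
    (hγ : ∀ i, 1 ≤ i → i ≤ n → |φtilde C S H i t| ≤ γ i) :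
    derivWithin (V P C xr S H) (Ici t) t ≤ -(aConst C * V P C xr S H t ^ C.q)
      - bConst C * V P C xr S H t ^ C.p + cConst C H lam s R γ := by
  have hκ := gainMin_pos (C := C) (by omega : 1 ≤ n)
  have hp := C.p_pos
  have hq := C.q_gt
  have h1 := hS.derivWithin_V_le hxr hC hn hA h0 hT hR
  set b := ∑ i ∈ Finset.Icc 1 n, φtilde C S H i t ^ 2 / (2 * C.ε i) with hb
  have hb0 : 0 ≤ b := sum_φtilde_sq_nonneg t
  have hbΓ : b ≤ ∑ i ∈ Finset.Icc 1 n, γ i ^ 2 / (2 * C.ε i) := by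
    refine Finset.sum_le_sum fun i hi => ?_
    obtain ⟨h1, hi⟩ := Finset.mem_Icc.1 hi
    have := one_lt_ε (C := C) h1 hi
    gcongr ?_ / _
    exact sq_le_sq.2 ((hγ i h1 hi).trans (le_abs_self _))
  have hq1 : aConst C * V P C xr S H t ^ C.q ≤
      gainMin C * ∑ i ∈ Finset.Icc 1 n, (z P C xr S i t ^ 2 / 2) ^ C.q +
      gainMin C / ((n : ℝ) + 1) * (∑ i ∈ Finset.Icc 1 n, γ i ^ 2 / (2 * C.ε i)) ^ C.q := by
    have hle := rpow_sum_add_le (n := n) (fun i => z P C xr S i t ^ 2 / 2)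
      (fun i => by positivity) hb0 hq.le
    have hn1 : (0 : ℝ) < (n : ℝ) + 1 := by positivity
    -- This explains the factor `gainMin / (n + 1)` in `cConst`; for the `z` terms it is relaxed to
    -- `gainMin`.
    have e : aConst C * ((n : ℝ) + 1) ^ (C.q - 1) = gainMin C / ((n : ℝ) + 1) := by
      rw [aConst, Real.rpow_sub_one hn1.ne']
      have : ((n : ℝ) + 1) ^ C.q ≠ 0 := (Real.rpow_pos_of_pos hn1 _).ne'
      field_simp
    have ha : 0 ≤ aConst C := by unfold aConst; positivity
    have h2 := mul_le_mul_of_nonneg_left hle ha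
    rw [← mul_assoc, e, mul_add] at h2
    rw [V_eq, ← hb]
    refine h2.trans (add_le_add ?_ ?_)
    · refine mul_le_mul_of_nonneg_right (div_le_self hκ.le (by simp)) ?_
      exact Finset.sum_nonneg fun i _ => by positivity
    · gcongr
  have hp1 : bConst C * V P C xr S H t ^ C.p ≤
      gainMin C * ∑ i ∈ Finset.Icc 1 n, (z P C xr S i t ^ 2 / 2) ^ C.p + gainMin C * b +
      gainMin C * ((1 - C.p) * C.p ^ (C.p / (1 - C.p))) := by
    rw [← mul_add, ← mul_add, bConst, V_eq, ← hb]
    refine mul_le_mul_of_nonneg_left ?_ hκ.le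
    have hz0 : 0 ≤ ∑ i ∈ Finset.Icc 1 n, z P C xr S i t ^ 2 / 2 :=
      Finset.sum_nonneg fun i _ => by positivity
    have e1 := Real.rpow_add_le_add_rpow hz0 hb0 hp.le C.p_lt.le
    have e2 := rpow_sum_le_sum_rpow (Finset.Icc 1 n) (fun i => z P C xr S i t ^ 2 / 2) hp
      C.p_lt.le (fun i _ => by positivity)
    have e3 := rpow_le_add_const hp C.p_lt hb0
    linarith
  simp only [cConst]
  simp only [baseConst] at h1
  linarith

lemma cConst_pos (hn : 1 ≤ n) (hR : 0 ≤ R) (γ : ℕ → ℝ) : 0 < cConst C H lam s R γ := by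
  have hκ := gainMin_pos (C := C) hn
  have hp := C.p_pos
  have hp1 : 0 < 1 - C.p := by linarith [C.p_lt]
  have h1 : 0 ≤ ∑ i ∈ Finset.Icc 1 n,
      (C.u i ^ 2 / 2 + lam i ^ 2 / 2 + C.f i * C.τ i / 2 * (‖H i‖ ^ 2) ^ 2) := by
    refine Finset.sum_nonneg fun i hi => ?_
    obtain ⟨h1, hi⟩ := Finset.mem_Icc.1 hi
    have := C.τ_pos i h1 hi
    have : 0 < C.f i := by linarith [C.f_gt i h1 hi]
    positivity
  have h2 : 0 ≤ ∑ i ∈ Finset.Icc 1 n, γ i ^ 2 / (2 * C.ε i) := by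
    refine Finset.sum_nonneg fun i hi => ?_
    obtain ⟨h1, hi⟩ := Finset.mem_Icc.1 hi
    have := one_lt_ε (C := C) h1 hi
    positivity
  have h3 := triggerConst_nonneg (C := C) (s := s) hR
  have h4 : 0 < gainMin C * ((1 - C.p) * C.p ^ (C.p / (1 - C.p))) := by positivity
  have h5 : 0 ≤ gainMin C / ((n : ℝ) + 1) *
    (∑ i ∈ Finset.Icc 1 n, γ i ^ 2 / (2 * C.ε i)) ^ C.q := by positivity
  unfold cConst
  linarith

lemma aConst_pos (hn : 1 ≤ n) : 0 < aConst C := by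
  have hκ := gainMin_pos (C := C) hn
  unfold aConst
  positivity

/-- Convergence to the residual set within the settling time. -/
lemma IsSolution.V_le_residual (hS : IsSolution P C xr S s T tk law)
    (hxr : AdmissibleReference P xr) (hC : C.Admissible s) (hn : 2 ≤ n)
    (hA : Approximates P C xr S H lam T)
    (hR : ∀ t : ℝ, 0 ≤ t → (t : EReal) < T → Delta P n (w P S n t) ≤ R) {γ : ℕ → ℝ}
    (hγ : ∀ i, 1 ≤ i → i ≤ n → ∀ t : ℝ, 0 ≤ t → (t : EReal) < T → |φtilde C S H i t| ≤ γ i)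
    {I : ℝ} (hI0 : 0 < I) (hI1 : I < 1) (hc : 0 < cConst C H lam s R γ) {t : ℝ}
    (ht : settlingTime C I ≤ t) (hT : (t : EReal) < T) :
    V P C xr S H t ≤ min ((cConst C H lam s R γ / ((1 - I) * aConst C)) ^ (1 / C.q))
      ((cConst C H lam s R γ / ((1 - I) * bConst C)) ^ (1 / C.p)) := by
  have hreg := hS.rightRegular_V (H := H) hxr
  have lt : ∀ x ∈ Ico 0 t, (x : EReal) < T := fun x hx =>
    (EReal.coe_lt_coe_iff.2 hx.2).trans hT
  exact le_residual_of_fixed_time (aConst_pos (by omega)) (gainMin_pos (by omega)) hc C.p_pos C.p_lt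
    C.q_gt hI0 hI1 (hreg.continuousOn_Icc le_rfl hT)
    (fun x hx => (hreg.2 x hx.1 (lt x hx)).hasDerivWithinAt)
    (fun x hx => hS.derivWithin_V_le_fixed_time hxr hC hn hA hx.1 (lt x hx) (hR x hx.1 (lt x hx))
      fun i h1 hi => hγ i h1 hi x hx.1 (lt x hx)) ht

/-! ### Inverse of the logarithmic transformation -/

/-- The inverse map is the logistic function `b - (a+b)/(1 + exp v)`, whose slope is at most
`(a+b)/4`, attained at `v = 0`. -/
lemma abs_sub_le_abs_log_sub {a b x y : ℝ} (hx1 : 0 < a + x) (hx2 : 0 < b - x) (hy1 : 0 < a + y)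
    (hy2 : 0 < b - y) : |x - y| ≤
      (a + b) / 4 * |Real.log ((a + x) / (b - x)) - Real.log ((a + y) / (b - y))| := by
  have hab : 0 < a + b := by linarith
  set X : ℝ → ℝ := fun v => b - (a + b) / (1 + Real.exp v) with hX
  have hinv : ∀ r, 0 < a + r → 0 < b - r → X (Real.log ((a + r) / (b - r))) = r := by
    intro r h1 h2
    simp only [hX]
    rw [Real.exp_log (div_pos h1 h2)]
    have : 1 + (a + r) / (b - r) = (a + b) / (b - r) := by field_simp; ring
    rw [this]
    field_simp
    ring
  have hderiv : ∀ v, HasDerivAt X ((a + b) * Real.exp v / (1 + Real.exp v) ^ 2) v := by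
    intro v
    have hpos : 1 + Real.exp v ≠ 0 := by positivity
    refine (((hasDerivAt_const v (a + b)).div ((Real.hasDerivAt_exp v).const_add 1)
      hpos).const_sub b).congr_deriv ?_
    ring
  have := Convex.norm_image_sub_le_of_norm_hasDerivWithin_le (f := X) (C := (a + b) / 4)
    (s := univ) (fun v _ => (hderiv v).hasDerivWithinAt) (fun v _ => by
      have := Real.exp_pos v
      rw [Real.norm_of_nonneg (by positivity), div_le_div_iff₀ (by positivity) (by norm_num)]
      nlinarith [mul_nonneg hab.le (sq_nonneg (Real.exp v - 1))]) convex_univ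
    (mem_univ (Real.log ((a + y) / (b - y)))) (mem_univ (Real.log ((a + x) / (b - x))))
  rwa [hinv x hx1 hx2, hinv y hy1 hy2] at this

lemma add_div_le_of_abs_log_le {a b x B : ℝ} (hx1 : 0 < a + x) (hx2 : 0 < b - x)
    (h : |Real.log ((a + x) / (b - x))| ≤ B) :
    (a + b) / (1 + Real.exp B) ≤ a + x ∧ (a + b) / (1 + Real.exp B) ≤ b - x := by
  obtain ⟨h1, h2⟩ := abs_le.1 h
  have e1 : a + x ≤ Real.exp B * (b - x) := by
    rwa [← div_le_iff₀ hx2, ← Real.log_le_iff_le_exp (div_pos hx1 hx2)]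
  have e2 : b - x ≤ Real.exp B * (a + x) := by
    rw [← div_le_iff₀ hx1, ← Real.log_le_iff_le_exp (div_pos hx2 hx1), ← inv_div, Real.log_inv]
    linarith
  have := Real.exp_pos B
  constructor <;> rw [div_le_iff₀ (by positivity)] <;> linarith

/-! ### Uniform bounds -/

/-- Signals that are bounded on `[0, T)`, with one bound for a class of runs. -/
def UniformlyBounded (𝓡 : Signals → EReal → Prop) (F : Signals → ℝ → ℝ) : Prop :=
  ∃ B : ℝ, ∀ S T, 𝓡 S T → ∀ t : ℝ, 0 ≤ t → (t : EReal) < T → |F S t| ≤ B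

namespace UniformlyBounded

variable {𝓡 : Signals → EReal → Prop} {F G : Signals → ℝ → ℝ}

lemma const (c : ℝ) : UniformlyBounded 𝓡 fun _ _ => c := ⟨|c|, fun _ _ _ _ _ _ => le_rfl⟩

lemma mono (hG : UniformlyBounded 𝓡 G)
    (h : ∀ S T, 𝓡 S T → ∀ t : ℝ, 0 ≤ t → (t : EReal) < T → |F S t| ≤ |G S t|) :
    UniformlyBounded 𝓡 F := by
  obtain ⟨B, hB⟩ := hG
  exact ⟨B, fun S T hST t h0 hT => (h S T hST t h0 hT).trans (hB S T hST t h0 hT)⟩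

lemma add (hF : UniformlyBounded 𝓡 F) (hG : UniformlyBounded 𝓡 G) :
    UniformlyBounded 𝓡 fun S t => F S t + G S t := by
  obtain ⟨A, hA⟩ := hF
  obtain ⟨B, hB⟩ := hG
  exact ⟨A + B, fun S T hST t h0 hT => (abs_add_le _ _).trans
    (add_le_add (hA S T hST t h0 hT) (hB S T hST t h0 hT))⟩

lemma neg (hF : UniformlyBounded 𝓡 F) : UniformlyBounded 𝓡 fun S t => -F S t :=
  hF.mono fun _ _ _ _ _ _ => (abs_neg _).le

lemma abs (hF : UniformlyBounded 𝓡 F) : UniformlyBounded 𝓡 fun S t => |F S t| :=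
  hF.mono fun _ _ _ _ _ _ => (abs_abs _).le

lemma sub (hF : UniformlyBounded 𝓡 F) (hG : UniformlyBounded 𝓡 G) :
    UniformlyBounded 𝓡 fun S t => F S t - G S t := by
  simpa only [sub_eq_add_neg] using hF.add hG.neg

lemma mul (hF : UniformlyBounded 𝓡 F) (hG : UniformlyBounded 𝓡 G) :
    UniformlyBounded 𝓡 fun S t => F S t * G S t := by
  obtain ⟨A, hA⟩ := hF
  obtain ⟨B, hB⟩ := hG
  refine ⟨A * B, fun S T hST t h0 hT => ?_⟩
  rw [abs_mul]
  have h := hA S T hST t h0 hT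
  exact mul_le_mul h (hB S T hST t h0 hT) (abs_nonneg _) ((abs_nonneg _).trans h)

lemma sum {ι : Type*} {s : Finset ι} {F : ι → Signals → ℝ → ℝ}
    (hF : ∀ i ∈ s, UniformlyBounded 𝓡 (F i)) :
    UniformlyBounded 𝓡 fun S t => ∑ i ∈ s, F i S t := by
  classical
  induction s using Finset.induction_on with
  | empty => simpa using const 0
  | insert a s ha ih =>
    simp only [Finset.sum_insert ha]
    exact (hF a (by simp)).add (ih fun i hi => hF i (by simp [hi]))

lemma comp_monotone {φ ψ : ℝ → ℝ} (hF : UniformlyBounded 𝓡 F)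
    (hψ : ∀ x y, 0 ≤ x → x ≤ y → ψ x ≤ ψ y) (hφ : ∀ x, |φ x| ≤ ψ |x|) :
    UniformlyBounded 𝓡 fun S t => φ (F S t) := by
  obtain ⟨B, hB⟩ := hF
  exact ⟨ψ B, fun S T hST t h0 hT =>
    (hφ _).trans (hψ _ _ (abs_nonneg _) (hB S T hST t h0 hT))⟩

lemma of_sq_le {K : ℝ} (h : ∀ S T, 𝓡 S T → ∀ t : ℝ, 0 ≤ t → (t : EReal) < T → F S t ^ 2 ≤ K) :
    UniformlyBounded 𝓡 F :=
  ⟨√K, fun S T hST t h0 hT => Real.abs_le_sqrt (h S T hST t h0 hT)⟩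

end UniformlyBounded

/-- Runs of the closed loop on `[0, T)` with `V 0 ≤ M`. -/
def Run (P : Plant n) (C : Controller n) (xr : ℝ → ℝ) (s : Scheme)
    (H : (i : ℕ) → EuclideanSpace ℝ (Fin (C.N i))) (lam : ℕ → ℝ) (R M : ℝ) (S : Signals)
    (T : EReal) : Prop :=
  (∃ (tk : ℕ → EReal) (law : ℕ → Law), IsSolution P C xr S s T tk law) ∧
    Approximates P C xr S H lam T ∧
    (∀ t : ℝ, 0 ≤ t → (t : EReal) < T → Delta P n (w P S n t) ≤ R) ∧ V P C xr S H 0 ≤ M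

/-- Each neuron is at most 1 whatever its input, so higher derivatives of `ws` in the network inputs
need no bounds. -/
lemma basis_norm_sq_le {i : ℕ} (h1 : 1 ≤ i) (hi : i ≤ n) (W : NNInput i) :
    ‖basis C i W‖ ^ 2 ≤ C.N i := by
  rw [EuclideanSpace.norm_sq_eq]
  have hw := C.width_pos i h1 hi
  refine (Finset.sum_le_card_nsmul _ _ 1 fun l _ => ?_).trans (by simp)
  have h : Real.exp (-‖W - C.center i l‖ / C.width i) ≤ 1 := by
    rw [Real.exp_le_one_iff, neg_div, neg_nonpos]
    positivity
  rw [sq_le_one_iff_abs_le_one, abs_norm]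
  simpa [basis, abs_of_pos (Real.exp_pos _)] using h

section Bounds

variable {M : ℝ}

lemma Run.V_le (hxr : AdmissibleReference P xr) (hC : C.Admissible s) (hn : 2 ≤ n) :
    ∀ S T, Run P C xr s H lam R M S T → ∀ t : ℝ, 0 ≤ t → (t : EReal) < T →
      V P C xr S H t ≤ max M (baseConst C H lam s R / gainMin C) := by
  rintro S T ⟨⟨tk, law, hS⟩, hA, hR, hM⟩ t h0 hT
  exact hS.V_le hxr hC hn hA hR hM h0 hT

lemma uniformlyBounded_z (hxr : AdmissibleReference P xr) (hC : C.Admissible s) (hn : 2 ≤ n)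
    {i : ℕ} (h1 : 1 ≤ i) (hi : i ≤ n) :
    UniformlyBounded (Run P C xr s H lam R M) fun S t => z P C xr S i t := by
  refine .of_sq_le (K := 2 * max M (baseConst C H lam s R / gainMin C)) fun S T hr t h0 hT => ?_
  have a := Run.V_le hxr hC hn S T hr t h0 hT
  have b := summand_le_V (P := P) (xr := xr) (S := S) (H := H) h1 hi t
  have := one_lt_ε (C := C) h1 hi
  have c : 0 ≤ φtilde C S H i t ^ 2 / (2 * C.ε i) := by positivity
  linarith

lemma uniformlyBounded_φtilde (hxr : AdmissibleReference P xr) (hC : C.Admissible s) (hn : 2 ≤ n)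
    {i : ℕ} (h1 : 1 ≤ i) (hi : i ≤ n) :
    UniformlyBounded (Run P C xr s H lam R M) fun S t => φtilde C S H i t := by
  have hε := one_lt_ε (C := C) h1 hi
  refine .of_sq_le (K := max M (baseConst C H lam s R / gainMin C) * (2 * C.ε i))
    fun S T hr t h0 hT => ?_
  have a := Run.V_le hxr hC hn S T hr t h0 hT
  have b := summand_le_V (P := P) (xr := xr) (S := S) (H := H) h1 hi t
  rw [← div_le_iff₀ (by positivity)]
  linarith [sq_nonneg (z P C xr S i t)]

lemma uniformlyBounded_φhat (hxr : AdmissibleReference P xr) (hC : C.Admissible s) (hn : 2 ≤ n)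
    {i : ℕ} (h1 : 1 ≤ i) (hi : i ≤ n) :
    UniformlyBounded (Run P C xr s H lam R M) fun S t => S.φhat i t := by
  have := (UniformlyBounded.const (‖H i‖ ^ 2)).sub
    (uniformlyBounded_φtilde (lam := lam) (R := R) (M := M) (H := H) hxr hC hn h1 hi)
  simpa [φtilde] using this

lemma uniformlyBounded_feedback (hxr : AdmissibleReference P xr) (hC : C.Admissible s)
    (hn : 2 ≤ n) {i : ℕ} (h1 : 1 ≤ i) (hi : i ≤ n) :
    UniformlyBounded (Run P C xr s H lam R M) fun S t => feedback P C xr S i t := by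
  have hz := uniformlyBounded_z (H := H) (lam := lam) (R := R) (M := M) hxr hC hn h1 hi
  have hq := C.q_gt
  have hb : UniformlyBounded (Run P C xr s H lam R M)
      fun S t => ‖basis C i (Z P xr S i t)‖ ^ 2 :=
    ⟨C.N i, fun S T _ t _ _ => by
      rw [abs_of_nonneg (by positivity)]; exact basis_norm_sq_le h1 hi _⟩
  exact ((UniformlyBounded.const _).mul (hz.comp_monotone (ψ := fun x => x ^ (2 * C.q - 1))
    (fun x y hx hxy => Real.rpow_le_rpow hx hxy (by linarith)) (abs_sig_le _))).sub
    ((((UniformlyBounded.const _).mul hz).mul (uniformlyBounded_φhat hxr hC hn h1 hi)).mul hb)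

lemma uniformlyBounded_ws (hxr : AdmissibleReference P xr) {𝓡 : Signals → EReal → Prop} :
    UniformlyBounded 𝓡 fun _ t => ws P xr t := by
  obtain ⟨-, ⟨η, hη, hb⟩, -⟩ := hxr
  have hlog : ∀ y, η ≤ y → y ≤ P.ρ₁ 1 + P.ρ₂ 1 →
      |Real.log y| ≤ max |Real.log η| |Real.log (P.ρ₁ 1 + P.ρ₂ 1)| := fun y h1 h2 =>
    abs_le_max_abs_abs (Real.log_le_log hη h1) (Real.log_le_log (hη.trans_le h1) h2)
  refine ⟨2 * max |Real.log η| |Real.log (P.ρ₁ 1 + P.ρ₂ 1)|, fun S T _ t h0 _ => ?_⟩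
  obtain ⟨h1, h2⟩ := hb t h0
  change |Real.log ((P.ρ₁ 1 + xr t) / (P.ρ₂ 1 - xr t))| ≤ _
  rw [Real.log_div (by linarith) (by linarith), two_mul]
  exact (abs_sub _ _).trans (add_le_add (hlog _ (by linarith) (by linarith))
    (hlog _ (by linarith) (by linarith)))

lemma uniformlyBounded_deriv_ws (hn : 1 ≤ n) (hxr : AdmissibleReference P xr)
    {𝓡 : Signals → EReal → Prop} : UniformlyBounded 𝓡 fun _ t => deriv (ws P xr) t := by
  have hΔ : UniformlyBounded 𝓡 fun _ t => Delta P 1 (ws P xr t) := by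
    have h1 := P.ρ₁_pos 1 le_rfl hn
    have h2 := P.ρ₂_pos 1 le_rfl hn
    refine (uniformlyBounded_ws hxr).comp_monotone
      (ψ := fun x => (Real.exp x + Real.exp x + 2) / (P.ρ₁ 1 + P.ρ₂ 1))
      (fun x y _ hxy => by gcongr) fun x => ?_
    rw [abs_of_pos (Delta_pos le_rfl hn x), Delta]
    gcongr
    · exact le_abs_self x
    · exact neg_le_abs x
  have hx : UniformlyBounded 𝓡 fun _ t => deriv xr t := by
    obtain ⟨-, -, K, hK⟩ := hxr
    exact ⟨K, fun _ _ _ t h0 _ => hK t h0⟩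
  exact (hΔ.mul hx).mono fun S T _ t h0 _ => by rw [(hasDerivAt_ws hxr h0).deriv]

/-- No recursion is needed: the feedback depends on `z i` and `φhat i`, already bounded through `V`,
and on bounded neurons. -/
lemma uniformlyBounded_virt (hxr : AdmissibleReference P xr) (hC : C.Admissible s) (hn : 2 ≤ n)
    {i : ℕ} (hi : i ≤ n) :
    UniformlyBounded (Run P C xr s H lam R M) fun S t => virt P C xr S i t := by
  rcases Nat.eq_zero_or_pos i with rfl | h1
  · exact uniformlyBounded_ws hxr
  · simp only [virt_eq h1]
    refine (uniformlyBounded_feedback hxr hC hn h1 hi).add ?_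
    split_ifs
    · exact uniformlyBounded_deriv_ws (by omega) hxr
    · exact .const 0

lemma uniformlyBounded_w (hxr : AdmissibleReference P xr) (hC : C.Admissible s) (hn : 2 ≤ n)
    {i : ℕ} (h1 : 1 ≤ i) (hi : i ≤ n) :
    UniformlyBounded (Run P C xr s H lam R M) fun S t => w P S i t := by
  have := (uniformlyBounded_z (H := H) (lam := lam) (R := R) (M := M) hxr hC hn h1 hi).add
    (uniformlyBounded_virt hxr hC hn (i := i - 1) (by omega))
  simpa [z] using this

lemma uniformlyBounded_alphaN (hxr : AdmissibleReference P xr) (hC : C.Admissible s)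
    (hn : 2 ≤ n) : UniformlyBounded (Run P C xr s H lam R M) fun S t => alphaN P C xr S t := by
  have hinv : UniformlyBounded (Run P C xr s H lam R M) fun S t => 1 / Delta P n (w P S n t) := by
    refine ⟨(P.ρ₁ n + P.ρ₂ n) / 2, fun S T _ t _ _ => ?_⟩
    have h1 := P.ρ₁_pos n (by omega) le_rfl
    have h2 := P.ρ₂_pos n (by omega) le_rfl
    rw [abs_of_pos (one_div_pos.2 (Delta_pos (by omega) le_rfl _)), Delta, one_div_div]
    gcongr
    linarith [Real.exp_pos (w P S n t), Real.exp_pos (-w P S n t)]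
  exact hinv.mul (uniformlyBounded_feedback hxr hC hn (by omega) le_rfl)

lemma uniformlyBounded_alpha (hxr : AdmissibleReference P xr) (hC : C.Admissible s)
    (hn : 2 ≤ n) {i : ℕ} (hi : i ≤ n) :
    UniformlyBounded (Run P C xr s H lam R M) fun S t => alpha P C xr S i t := by
  unfold alpha
  split_ifs
  · exact uniformlyBounded_alphaN hxr hC hn
  · exact uniformlyBounded_virt hxr hC hn hi

lemma uniformlyBounded_dLaw (hxr : AdmissibleReference P xr) (hC : C.Admissible s)
    (hn : 2 ≤ n) (l : Law) :
    UniformlyBounded (Run P C xr s H lam R M) fun S t => dLaw P C xr S l t := by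
  have ha := uniformlyBounded_alphaN (H := H) (lam := lam) (R := R) (M := M) hxr hC hn
  have ht : ∀ F : Signals → ℝ → ℝ,
      UniformlyBounded (Run P C xr s H lam R M) fun S t => Real.tanh (F S t) :=
    fun F => ⟨1, fun _ _ _ _ _ _ => abs_tanh_le_one _⟩
  cases l
  · exact ha.sub ((UniformlyBounded.const _).mul (ht _))
  · exact (UniformlyBounded.const _).mul
      ((ha.mul (ht _)).add ((UniformlyBounded.const _).mul (ht _)))

/-- The input is the value of one of the laws at an earlier time of `[0, T)`, so uniform bounds on
both laws also cover `g`. -/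
lemma uniformlyBounded_input (hxr : AdmissibleReference P xr) (hC : C.Admissible s)
    (hn : 2 ≤ n) : UniformlyBounded (Run P C xr s H lam R M) fun S t => |S.d t| + |S.g t| := by
  obtain ⟨B₁, h₁⟩ := uniformlyBounded_dLaw (H := H) (lam := lam) (R := R) (M := M) hxr hC hn .fixed
  obtain ⟨B₂, h₂⟩ :=
    uniformlyBounded_dLaw (H := H) (lam := lam) (R := R) (M := M) hxr hC hn .relative
  refine ⟨max B₁ B₂ + max B₁ B₂, fun S T hr t h0 hT => ?_⟩
  have hl : ∀ (l : Law) (r : ℝ), 0 ≤ r → (r : EReal) < T → |dLaw P C xr S l r| ≤ max B₁ B₂ := by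
    intro l r hr0 hrT
    cases l
    · exact (h₁ S T hr r hr0 hrT).trans (le_max_left _ _)
    · exact (h₂ S T hr r hr0 hrT).trans (le_max_right _ _)
  obtain ⟨⟨tk, law, hS⟩, -⟩ := hr
  obtain ⟨l, s₀, hs0, hsT, hd, hg, -⟩ := hS.exists_sample hxr hC (by omega) h0 hT
  change |(|S.d t| + |S.g t|)| ≤ _
  rw [abs_of_nonneg (by positivity), hd, hg]
  exact add_le_add (hl l t h0 hT) (hl l s₀ hs0 hsT)

end Bounds

end Boundedness

/-! ### Assembly of the uniform bounds and the tracking estimate -/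

section Conclusion

variable {n : ℕ} {P : Plant n} {C : Controller n} {xr : ℝ → ℝ} {s : Scheme}
  {H : (i : ℕ) → EuclideanSpace ℝ (Fin (C.N i))} {lam : ℕ → ℝ} {R : ℝ}

lemma exists_uniform_bound (hn : 2 ≤ n) (hC : C.Admissible s) (hxr : AdmissibleReference P xr)
    (M : ℝ) : ∃ B η : ℝ, 0 < η ∧ ∀ S T, Run P C xr s H lam R M S T →
      ∀ t : ℝ, 0 ≤ t → (t : EReal) < T →
        |S.d t| ≤ B ∧ |S.g t| ≤ B ∧ ∀ i, 1 ≤ i → i ≤ n →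
          -P.ρ₁ i + η ≤ S.x i t ∧ S.x i t ≤ P.ρ₂ i - η ∧ |w P S i t| ≤ B ∧
          |z P C xr S i t| ≤ B ∧ |alpha P C xr S i t| ≤ B ∧
          |S.φhat i t| ≤ B ∧ |φtilde C S H i t| ≤ B := by
  set E : ℕ → Signals → ℝ → ℝ := fun i S t => |w P S i t| + |z P C xr S i t| +
    |alpha P C xr S i t| + |S.φhat i t| + |φtilde C S H i t| with hE
  obtain ⟨B, hB⟩ : UniformlyBounded (Run P C xr s H lam R M) fun S t =>
      (|S.d t| + |S.g t|) + ∑ i ∈ Finset.Icc 1 n, E i S t := by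
    refine (uniformlyBounded_input hxr hC hn).add (.sum fun i hi => ?_)
    obtain ⟨h1, hi⟩ := Finset.mem_Icc.1 hi
    exact ((((uniformlyBounded_w hxr hC hn h1 hi).abs.add
      (uniformlyBounded_z hxr hC hn h1 hi).abs).add
      (uniformlyBounded_alpha hxr hC hn hi).abs).add
      (uniformlyBounded_φhat hxr hC hn h1 hi).abs).add
      (uniformlyBounded_φtilde hxr hC hn h1 hi).abs
  -- The shortest constraint interval determines a margin `η` valid for all states.
  obtain ⟨k, hk, hmin⟩ := (Finset.Icc 1 n).exists_min_image (fun i => P.ρ₁ i + P.ρ₂ i)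
    ⟨1, Finset.mem_Icc.2 ⟨le_rfl, by omega⟩⟩
  obtain ⟨hk1, hkn⟩ := Finset.mem_Icc.1 hk
  have hρ₁ := P.ρ₁_pos k hk1 hkn
  have hρ₂ := P.ρ₂_pos k hk1 hkn
  refine ⟨B, (P.ρ₁ k + P.ρ₂ k) / (1 + Real.exp B), by positivity, fun S T hr t h0 hT => ?_⟩
  have hsum := (le_abs_self _).trans (hB S T hr t h0 hT)
  simp only at hsum
  have hE0 : ∀ i, 0 ≤ E i S t := fun i => by simp only [hE]; positivity
  have hS0 : 0 ≤ ∑ i ∈ Finset.Icc 1 n, E i S t := Finset.sum_nonneg fun i _ => hE0 i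
  have hd := abs_nonneg (S.d t)
  have hg := abs_nonneg (S.g t)
  refine ⟨by linarith, by linarith, fun i h1 hi => ?_⟩
  have hle : E i S t ≤ B := by
    have := Finset.single_le_sum (f := fun i => E i S t) (fun i _ => hE0 i)
      (Finset.mem_Icc.2 ⟨h1, hi⟩)
    linarith
  simp only [hE] at hle
  have e1 := abs_nonneg (w P S i t)
  have e2 := abs_nonneg (z P C xr S i t)
  have e3 := abs_nonneg (alpha P C xr S i t)
  have e4 := abs_nonneg (S.φhat i t)
  have e5 := abs_nonneg (φtilde C S H i t)
  have hw : |w P S i t| ≤ B := by linarith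
  obtain ⟨⟨tk, law, hS⟩, -⟩ := hr
  obtain ⟨hx1, hx2⟩ := hS.x_mem i h1 hi t h0 hT
  obtain ⟨m1, m2⟩ := add_div_le_of_abs_log_le (by linarith) (by linarith) hw
  have hm : (P.ρ₁ k + P.ρ₂ k) / (1 + Real.exp B) ≤ (P.ρ₁ i + P.ρ₂ i) / (1 + Real.exp B) := by
    gcongr ?_ / _
    exact hmin i (Finset.mem_Icc.2 ⟨h1, hi⟩)
  exact ⟨by linarith, by linarith, hw, by linarith, by linarith, by linarith, by linarith⟩

lemma abs_z_le_of_V_le {S : Signals} {i : ℕ} (h1 : 1 ≤ i) (hi : i ≤ n) {t r q : ℝ} (hr : 0 ≤ r)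
    (h : V P C xr S H t ≤ r ^ (1 / q)) :
    |z P C xr S i t| ≤ √2 * r ^ (1 / (2 * q)) := by
  have hε := one_lt_ε (C := C) h1 hi
  have h2 := summand_le_V (P := P) (xr := xr) (S := S) (H := H) h1 hi t
  have h3 : 0 ≤ φtilde C S H i t ^ 2 / (2 * C.ε i) := by positivity
  refine abs_le_of_sq_le_sq ?_ (by positivity)
  have e : (r ^ (1 / (2 * q))) ^ 2 = r ^ (1 / q) := by
    rw [← Real.rpow_natCast, ← Real.rpow_mul hr]
    congr 1
    push_cast
    rw [mul_comm 2 q, ← div_div]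
    ring
  rw [mul_pow, e, Real.sq_sqrt (by norm_num)]
  linarith

end Conclusion

end FixedTimeETC

open FixedTimeETC in
theorem mainTheorem1 {n : ℕ} (hn : 2 ≤ n) (P : Plant n) (C : Controller n) (s : Scheme)
    (hC : C.Admissible s) (xr : ℝ → ℝ) (hxr : AdmissibleReference P xr)
    (H : (i : ℕ) → EuclideanSpace ℝ (Fin (C.N i))) (lam : ℕ → ℝ) (R : ℝ)
    (I : ℝ) (hI0 : 0 < I) (hI1 : I < 1) :
    -- boundedness of all signals, uniformly over bounded sets of initial conditions
    (∀ M : ℝ, ∃ B η : ℝ, 0 < η ∧ ∀ (S : Signals) (T : EReal) (tk : ℕ → EReal) (law : ℕ → Law),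
      IsSolution P C xr S s T tk law →
      Approximates P C xr S H lam T →
      (∀ t : ℝ, 0 ≤ t → (t : EReal) < T → Delta P n (w P S n t) ≤ R) →
      V P C xr S H 0 ≤ M →
      ∀ t : ℝ, 0 ≤ t → (t : EReal) < T →
        |S.d t| ≤ B ∧ |S.g t| ≤ B ∧ ∀ i, 1 ≤ i → i ≤ n →
          -P.ρ₁ i + η ≤ S.x i t ∧ S.x i t ≤ P.ρ₂ i - η ∧ |w P S i t| ≤ B ∧
          |z P C xr S i t| ≤ B ∧ |alpha P C xr S i t| ≤ B ∧
          |S.φhat i t| ≤ B ∧ |φtilde C S H i t| ≤ B) ∧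
    -- convergence to the residual set and tracking accuracy after the settling time
    (∀ (S : Signals) (T : EReal) (tk : ℕ → EReal) (law : ℕ → Law),
      IsSolution P C xr S s T tk law →
      Approximates P C xr S H lam T →
      (∀ t : ℝ, 0 ≤ t → (t : EReal) < T → Delta P n (w P S n t) ≤ R) →
      ∀ γ : ℕ → ℝ,
      (∀ i, 1 ≤ i → i ≤ n → ∀ t : ℝ, 0 ≤ t → (t : EReal) < T → |φtilde C S H i t| ≤ γ i) →
      ∀ t : ℝ, settlingTime C I ≤ t → (t : EReal) < T →
        V P C xr S H t ≤
          min ((cConst C H lam s R γ / ((1 - I) * aConst C)) ^ (1 / C.q))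
            ((cConst C H lam s R γ / ((1 - I) * bConst C)) ^ (1 / C.p)) ∧
        |w P S 1 t - ws P xr t| ≤
          2 * (cConst C H lam s R γ / ((1 - I) * aConst C)) ^ (1 / (2 * C.q)) ∧
        |S.x 1 t - xr t| ≤
          Real.sqrt 2 / 4 * (P.ρ₁ 1 + P.ρ₂ 1) *
            (cConst C H lam s R γ / ((1 - I) * aConst C)) ^ (1 / (2 * C.q))) := by
  constructor
  · intro M
    obtain ⟨B, η, hη, h⟩ := exists_uniform_bound (H := H) (lam := lam) (R := R) hn hC hxr M
    exact ⟨B, η, hη, fun S T tk law hS hA hR hM => h S T ⟨⟨tk, law, hS⟩, hA, hR, hM⟩⟩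
  · intro S T tk law hS hA hR γ hγ t ht hT
    -- Time 0 belongs to `[0, T)`, and there `R` bounds a positive quantity.
    have hR0 : 0 ≤ R := (Delta_pos (by omega) le_rfl _).le.trans
      (hR 0 le_rfl (by simpa using hS.T_pos))
    have hc := cConst_pos (C := C) (H := H) (lam := lam) (s := s) (by omega) hR0 γ
    have hV := hS.V_le_residual hxr hC hn hA hR hγ hI0 hI1 hc ht hT
    have ha := aConst_pos (C := C) (by omega : 1 ≤ n)
    have hb : 0 < bConst C := gainMin_pos (by omega)
    have hI' : 0 < 1 - I := by linarith
    have hr : 0 ≤ cConst C H lam s R γ / ((1 - I) * aConst C) := by positivity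
    have hz : |w P S 1 t - ws P xr t| ≤
        √2 * (cConst C H lam s R γ / ((1 - I) * aConst C)) ^ (1 / (2 * C.q)) :=
      abs_z_le_of_V_le le_rfl (by omega) hr (hV.trans (min_le_left _ _))
    have h0 : 0 ≤ t := by
      have h1 : 0 < C.q - 1 := by linarith [C.q_gt]
      have h2 : 0 < 1 - C.p := by linarith [C.p_lt]
      refine le_trans ?_ ht
      unfold settlingTime
      positivity
    refine ⟨hV, hz.trans ?_, ?_⟩
    -- Only `√2 ≤ 2` is lost here; the sharper `√2` is kept for the bound in the original
    -- coordinates.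
    · gcongr
      exact Real.sqrt_le_iff.2 ⟨by norm_num, by norm_num⟩
    · obtain ⟨hx1, hx2⟩ := hS.x_mem 1 le_rfl (by omega) t h0 hT
      obtain ⟨-, ⟨η, hη, href⟩, -⟩ := hxr
      obtain ⟨hr1, hr2⟩ := href t h0
      have hρ₁ := P.ρ₁_pos 1 le_rfl (by omega)
      have hρ₂ := P.ρ₂_pos 1 le_rfl (by omega)
      refine (abs_sub_le_abs_log_sub (a := P.ρ₁ 1) (b := P.ρ₂ 1) (by linarith) (by linarith)
        (by linarith) (by linarith)).trans ?_
      refine (mul_le_mul_of_nonneg_left hz (by positivity)).trans (le_of_eq ?_)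
      ring
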